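/- Let $\lambda>\gamma$ be infinite regular cardinals. All groups are abelian, and $\operatorname{Ext}=\operatorname{Ext}^1_{\mathbb Z}$. A group $T$ is cotorsion if $\operatorname{Ext}(\mathbb Q,T)=0$. A group is $\gamma$-free if all its subgroups of cardinality $<\gamma$ are free; it is strongly $\gamma$-free if it is $\gamma$-free and every subgroup of cardinality $<\gamma$ is contained in a subgroup $K$ of cardinality $<\gamma$ such that the quotient by $K$ is $\gamma$-free. For a group $T$ with $|T|<\lambda$, a group $G$ is called $(T,\lambda,\gamma)$-suitable if $\operatorname{Ext}(G,T)\neq 0$ and there are a free group $F$ and free subgroups $F_i\subseteq F$ ($i\le\gamma$) such that: $F_i\subseteq F_j$ for $i\le j\le\gamma$ and $F_\gamma=\bigcup_{i<\gamma}F_i$; $\operatorname{rk}(F_i)\le |i|+\aleph_0$ for all $i\le\gamma$; $F/F_i$ is free for all $i<\gamma$; and $F/F_\gamma\cong G$. Let $S\subseteq\gamma$ be stationary in $\gamma$ and non-reflecting (that is, $S\cap\alpha$ is not stationary in $\alpha$ for any $\alpha<\gamma$ of uncountable cofinality), with $\operatorname{cf}(\alpha)=\omega$ for all $\alpha\in S$.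 Assume $\Diamond_S$: there are sets $A_\alpha\subseteq\alpha$ ($\alpha\in S$) such that for every $X\subseteq\gamma$ the set $\{\alpha\in S : X\cap\alpha=A_\alpha\}$ is stationary in $\gamma$. Let $T$ be a group with $|T|<\lambda$ that is not cotorsion and has an epimorphic image of cardinality $\le\gamma$ that is not cotorsion. Then there exists a strongly $\gamma$-free torsion-free group $G$ of cardinality $\gamma$ that is $(T,\lambda,\gamma)$-suitable. In particular, the conclusion holds for every non-cotorsion group $T$ with $|T|<\lambda$ that is torsion or satisfies $|T|\le\gamma$. -/

import Mathlib

open Cardinal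

universe u

/-- The set `S` of ordinals is stationary in the ordinal `δ`: the set `S ∩ δ` meets every
closed unbounded subset of `δ`. -/
def StationaryIn (S : Set Ordinal.{u}) (δ : Ordinal.{u}) : Prop :=
  IsStationary (Subtype.val ⁻¹' S : Set (Set.Iio δ))

/-- The set `S` does not reflect at any `α < δ` (necessarily a limit ordinal) of uncountable
cofinality: `S ∩ α` is not stationary in `α`. -/
def NonReflectingIn (S : Set Ordinal.{u}) (δ : Ordinal.{u}) : Prop :=
  ∀ α < δ, ℵ₀ < α.cof → ¬ StationaryIn S α

/-- The diamond principle `◇_S` for a subset `S` of `δ`: there are sets `A α ⊆ α` (`α ∈ S`) such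
that for every `X ⊆ δ` the set of all `α ∈ S` with `X ∩ α = A α` is stationary in `δ`. -/
def DiamondOn (S : Set Ordinal.{u}) (δ : Ordinal.{u}) : Prop :=
  ∃ A : Ordinal.{u} → Set Ordinal.{u},
    (∀ α ∈ S, A α ⊆ Set.Iio α) ∧
    ∀ X ⊆ Set.Iio δ, StationaryIn {α | α ∈ S ∧ X ∩ Set.Iio α = A α} δ

/-- The group `Ext(G, T) = Ext¹_ℤ(G, T)` of abelian groups. -/
abbrev ZExt (G T : Type u) [AddCommGroup G] [AddCommGroup T] : Type u :=
  CategoryTheory.Abelian.Ext.{u} (ModuleCat.of ℤ G) (ModuleCat.of ℤ T) 1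

/-- An abelian group `T` is cotorsion if `Ext(ℚ, T) = 0`. -/
def IsCotorsion (T : Type u) [AddCommGroup T] : Prop :=
  Subsingleton (ZExt (ULift.{u} ℚ) T)

/-- `G` is `γ`-free: all its subgroups of cardinality less than `γ` are free. -/
def IsKappaFree (γ : Cardinal.{u}) (G : Type u) [AddCommGroup G] : Prop :=
  ∀ H : AddSubgroup G, #H < γ → Module.Free ℤ H

/-- `G` is strongly `γ`-free: it is `γ`-free, and every subgroup of cardinality less than `γ` is
contained in a subgroup `K` of cardinality less than `γ` such that `G/K` is `γ`-free. -/
def IsStronglyKappaFree (γ : Cardinal.{u}) (G : Type u) [AddCommGroup G] : Prop :=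
  IsKappaFree γ G ∧
    ∀ H : AddSubgroup G, #H < γ →
      ∃ K : AddSubgroup G, H ≤ K ∧ #K < γ ∧ IsKappaFree γ (G ⧸ K)

/-- `G` is `(T, lam, γ)`-suitable. The chain `Fc i` is only considered for `i ≤ γ`, where the
cardinal `γ` is identified with its initial ordinal. -/
structure IsSuitable (T : Type u) [AddCommGroup T] (lam γ : Cardinal.{u})
    (G : Type u) [AddCommGroup G] : Prop where
  card_lt : #T < lam
  ext_ne_zero : Nontrivial (ZExt G T)
  exists_chain : ∃ (F : Type u) (_ : AddCommGroup F) (Fc : Ordinal.{u} → AddSubgroup F),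
    Module.Free ℤ F ∧
    (∀ i ≤ γ.ord, Module.Free ℤ (Fc i)) ∧
    (∀ i j, i ≤ j → j ≤ γ.ord → Fc i ≤ Fc j) ∧
    (Fc γ.ord : Set F) = ⋃ i < γ.ord, (Fc i : Set F) ∧
    (∀ i ≤ γ.ord, Module.rank ℤ (Fc i) ≤ i.card + ℵ₀) ∧
    (∀ i < γ.ord, Module.Free ℤ (F ⧸ Fc i)) ∧
    Nonempty ((F ⧸ Fc γ.ord) ≃+ G)

/-! ### Vanishing of Ext as extendability of homomorphisms -/

section ExtOne
open CategoryTheory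

/-! Choose for each `δ ∈ S` a ladder `η δ` of type ω cofinal in `δ`. Let `F` be free on `x w` and `y
w n` (`w < γ`, `n < ω`), let `F_i` be spanned by the relators `x (η δ n) - y δ n + (n + 1) y δ (n +
1)` with `δ ∈ S`, `δ < i`, and put `G = F / F_γ`.

Freeness: as `S` does not reflect, the ladders below any `j < γ` become disjoint after cutting off
initial pieces (`exists_disjoint_tails`). The relators on the tails then eliminate distinct `x`'s,
and the finitely many others on each ladder eliminate `y`'s (`exists_retraction`), so `F / F_i` is
free for `i < γ`. A small subgroup of `G` only involves a bounded set of generators; hence `G` is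
γ-free, and so is its quotient by the generators below any `β ∉ S`.

Ext: since ℚ is presented by `e n = (n + 1) e (n + 1)`, a non-cotorsion `B` has an unsolvable system
`y n - (n + 1) y (n + 1) = b n`. Diamond guesses the images in `B` of the `x`'s under a map `F → T →
B`. A map `F_γ → T` is defined so that, if it extended to `F`, the `y`'s of a correctly guessed `δ`
would solve the system (`nontrivial_ext_of_guesses`). If `T` is torsion, a suitable countable image
`B` is found by a cardinality argument. -/

lemma ModuleCat.shortExact_ofHom {M₁ M₂ M₃ : Type u} [AddCommGroup M₁] [AddCommGroup M₂]
    [AddCommGroup M₃] (f : M₁ →+ M₂) (g : M₂ →+ M₃) (hf : Function.Injective f)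
    (hg : Function.Surjective g) (hfg : Function.Exact f g) :
    (ShortComplex.mk (ModuleCat.ofHom f.toIntLinearMap) (ModuleCat.ofHom g.toIntLinearMap)
      (by ext x; exact hfg.apply_apply_eq_zero x)).ShortExact := by
  have : Mono (ModuleCat.ofHom f.toIntLinearMap) := (ModuleCat.mono_iff_injective _).2 hf
  have : Epi (ModuleCat.ofHom g.toIntLinearMap) := (ModuleCat.epi_iff_surjective _).2 hg
  refine { exact := ?_ }
  rw [ShortComplex.ShortExact.moduleCat_exact_iff_function_exact]
  exact hfg

/-- If `0 → A → F → G → 0` is exact and `Ext(G, T) = 0`, then homomorphisms `A → T` extend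
to `F`. -/
lemma exists_extension_of_subsingleton_ext {A F G T : Type u} [AddCommGroup A] [AddCommGroup F]
    [AddCommGroup G] [AddCommGroup T] (i : A →+ F) (p : F →+ G) (hi : Function.Injective i)
    (hp : Function.Surjective p) (hip : Function.Exact i p) (h : Subsingleton (ZExt G T))
    (ψ : A →+ T) : ∃ φ : F →+ T, φ.comp i = ψ := by
  have hS := ModuleCat.shortExact_ofHom i p hi hp hip
  obtain ⟨x₂, hx₂⟩ := Abelian.Ext.contravariant_sequence_exact₁ hS (ModuleCat.of ℤ T)
    (Abelian.Ext.mk₀ (ModuleCat.ofHom ψ.toIntLinearMap)) (n₁ := 1) rfl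
    (Subsingleton.elim (α := ZExt G T) _ _)
  obtain ⟨f, rfl⟩ := (Abelian.Ext.mk₀_bijective _ _).2 x₂
  rw [Abelian.Ext.mk₀_comp_mk₀] at hx₂
  have h2 := (Abelian.Ext.mk₀_bijective _ _).1 hx₂
  refine ⟨f.hom.toAddMonoidHom, ?_⟩
  ext x
  exact congrArg (fun g => g.hom x) h2

/-- If `0 → A → F → G → 0` is exact, `F` is free and homomorphisms `A → T` extend to `F`, then
`Ext(G, T) = 0`. -/
lemma subsingleton_ext_of_exists_extension {A F G T : Type u} [AddCommGroup A] [AddCommGroup F]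
    [Module.Free ℤ F]
    [AddCommGroup G] [AddCommGroup T] (i : A →+ F) (p : F →+ G) (hi : Function.Injective i)
    (hp : Function.Surjective p) (hip : Function.Exact i p)
    (h : ∀ ψ : A →+ T, ∃ φ : F →+ T, φ.comp i = ψ) : Subsingleton (ZExt G T) := by
  have hS := ModuleCat.shortExact_ofHom i p hi hp hip
  have : Projective (ModuleCat.of ℤ F) := (IsProjective.iff_projective _).1 inferInstance
  refine subsingleton_of_forall_eq 0 fun x => ?_
  obtain ⟨x₁, hx₁⟩ := Abelian.Ext.contravariant_sequence_exact₃ hS (ModuleCat.of ℤ T)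
    (x₃ := x) (Abelian.Ext.eq_zero_of_projective _) (n₀ := 0) rfl
  obtain ⟨f, rfl⟩ := (Abelian.Ext.mk₀_bijective _ _).2 x₁
  obtain ⟨φ, hφ⟩ := h f.hom.toAddMonoidHom
  have hf : f = ModuleCat.ofHom i.toIntLinearMap ≫ ModuleCat.ofHom φ.toIntLinearMap := by
    ext x
    exact (DFunLike.congr_fun hφ x).symm
  rw [← hx₁, hf, ← Abelian.Ext.mk₀_comp_mk₀]
  exact hS.extClass_comp_assoc _

end ExtOne

/-! ### Cotorsion groups and factorial systems of equations -/

section FactorialSystems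
open Nat

/-- All systems `y n - (n + 1) y (n + 1) = b n` are solvable in `B`. -/
def FactorialSystemsSolvable (B : Type*) [AddCommGroup B] : Prop :=
  ∀ b : ℕ → B, ∃ y : ℕ → B, ∀ n, y n - (n + 1) • y (n + 1) = b n

/-- The descending chain of the subgroups `n! B` does not become stationary. -/
def FactorialChainNonstationary (B : Type*) [AddCommGroup B] : Prop :=
  ∀ N : ℕ, ∃ M : ℕ, ∃ q : B, ∀ q' : B, N ! • q ≠ M ! • q'

/-- Modulo `K`, every basis vector is a multiple of any later one, so `v` is congruent to `m` times
the `N`-th one for large `N`. Its value in ℚ is then `m / N!`, which forces `m = 0`. -/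
lemma mem_of_linearCombination_inv_factorial_eq_zero (K : AddSubgroup (ULift.{u} ℕ →₀ ℤ))
    (hK : ∀ n : ℕ, Finsupp.single (ULift.up n) 1 - (n + 1) • Finsupp.single (ULift.up (n + 1)) 1 ∈ K)
    (v : ULift.{u} ℕ →₀ ℤ)
    (hv : Finsupp.linearCombination ℤ (fun n : ULift.{u} ℕ => ((n.down)! : ℚ)⁻¹) v = 0) :
    v ∈ K := by
  set L := Finsupp.linearCombination ℤ (fun n : ULift.{u} ℕ => ((n.down)! : ℚ)⁻¹) with hL
  have key : ∀ v : ULift.{u} ℕ →₀ ℤ, ∃ N₀ : ℕ, ∀ N ≥ N₀, ∃ m : ℤ,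
      L v = m • ((N ! : ℚ)⁻¹) ∧ v - m • Finsupp.single (ULift.up N) 1 ∈ K := by
    intro v
    induction v using Finsupp.induction_linear with
    | zero => exact ⟨0, fun N _ => ⟨0, by simp⟩⟩
    | add f g hf hg =>
      obtain ⟨N₁, h₁⟩ := hf
      obtain ⟨N₂, h₂⟩ := hg
      refine ⟨max N₁ N₂, fun N hN => ?_⟩
      obtain ⟨m₁, h₁, h₁'⟩ := h₁ N (le_of_max_le_left hN)
      obtain ⟨m₂, h₂, h₂'⟩ := h₂ N (le_of_max_le_right hN)
      refine ⟨m₁ + m₂, by rw [map_add, h₁, h₂, add_smul], ?_⟩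
      convert K.add_mem h₁' h₂' using 1
      module
    | single a b =>
      obtain ⟨a⟩ := a
      refine ⟨a, fun N hN => ?_⟩
      induction N, hN using Nat.le_induction with
      | base => exact ⟨b, by simp [hL], by simp⟩
      | succ N _ ih =>
        obtain ⟨m, h, h'⟩ := ih
        refine ⟨m * (N + 1), ?_, ?_⟩
        · rw [h, Nat.factorial_succ]
          have : (N ! : ℚ) ≠ 0 := by positivity
          simp only [zsmul_eq_mul]
          push_cast
          field_simp
        · convert K.add_mem h' (K.zsmul_mem (hK N) m) using 1
          module
  obtain ⟨N, hN⟩ := key v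
  obtain ⟨m, h, h'⟩ := hN N le_rfl
  have hN : ((N ! : ℚ)⁻¹) ≠ 0 := by positivity
  have hm : m = 0 := by simpa [hN, hv, Nat.factorial_ne_zero] using h
  simpa [hm] using h'

lemma FactorialSystemsSolvable.isCotorsion {B : Type u} [AddCommGroup B]
    (hB : FactorialSystemsSolvable B) : IsCotorsion B := by
  let L := Finsupp.linearCombination ℤ (fun n : ULift.{u} ℕ => ((n.down)! : ℚ)⁻¹)
  let p : (ULift.{u} ℕ →₀ ℤ) →+ ULift.{u} ℚ :=
    AddEquiv.ulift.symm.toAddMonoidHom.comp L.toAddMonoidHom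
  have hpL : ∀ v, p v = 0 ↔ L v = 0 := fun v => by
    simp [p]
  have hk : ∀ n : ℕ, Finsupp.single (ULift.up n) 1
      - (n + 1) • Finsupp.single (ULift.up (n + 1)) 1 ∈ p.ker := by
    intro n
    rw [AddMonoidHom.mem_ker, hpL, map_sub, map_nsmul]
    simp only [L, Finsupp.linearCombination_single, Nat.factorial_succ]
    have : (n ! : ℚ) ≠ 0 := by positivity
    simp only [nsmul_eq_mul, one_smul]
    push_cast
    field_simp
    simp
  refine subsingleton_ext_of_exists_extension p.ker.subtype p p.ker.subtype_injective ?_ ?_ ?_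
  · rintro ⟨q⟩
    -- `num / den = num * (den - 1)! / den!`.
    refine ⟨Finsupp.single (ULift.up q.den) (q.num * ((q.den - 1)! : ℕ)), ?_⟩
    apply ULift.down_injective
    change L _ = q
    obtain ⟨d, hd⟩ := Nat.exists_eq_succ_of_ne_zero q.den_nz
    have hd' : ((d !:ℕ) : ℚ) ≠ 0 := by positivity
    have : (q.num : ℚ) / q.den = q := q.num_div_den
    simp only [L, Finsupp.linearCombination_single]
    rw [hd] at this ⊢
    nth_rewrite 2 [← this]
    simp only [Nat.succ_eq_add_one, Nat.factorial_succ, zsmul_eq_mul, Nat.add_sub_cancel]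
    push_cast
    field_simp
  · intro v
    simp
  · intro ψ
    obtain ⟨y, hy⟩ := hB fun n => ψ ⟨_, hk n⟩
    let χ := Finsupp.linearCombination ℤ (fun n : ULift.{u} ℕ => y n.down)
    refine ⟨χ.toAddMonoidHom, ?_⟩
    -- The part of the kernel where `χ` and `ψ` agree contains all relations of the presentation,
    -- hence is the whole kernel.
    let K := ((χ.toAddMonoidHom.comp p.ker.subtype).eqLocus ψ).map p.ker.subtype
    have hK : ∀ n : ℕ, Finsupp.single (ULift.up n) 1
        - (n + 1) • Finsupp.single (ULift.up (n + 1)) 1 ∈ K := fun n => by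
      refine ⟨⟨_, hk n⟩, ?_, rfl⟩
      change χ _ = ψ _
      rw [← hy n]
      change χ (Finsupp.single (ULift.up n) 1
        - (n + 1) • Finsupp.single (ULift.up (n + 1)) 1) = _
      rw [map_sub, map_nsmul]
      simp [χ]
    ext ⟨v, hv⟩
    obtain ⟨w, hw, hwv⟩ := mem_of_linearCombination_inv_factorial_eq_zero K hK v ((hpL v).1 hv)
    have : w = ⟨v, hv⟩ := Subtype.ext hwv
    rw [← this]
    exact hw

/-- Each set `s` of naturals gives a right-hand side, supported on the sparse places `a k` with `k ∈
s`. As `Q` is countable, two sets have solutions with the same initial term. Multiplying the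
difference by `n!` makes it telescope, and at the first `k` where the sets differ `(a k)! q` becomes
a multiple of `(M (a k))!`, against the choice of `q`. -/
lemma FactorialChainNonstationary.not_solvable {Q : Type*} [AddCommGroup Q] [Countable Q]
    (h : FactorialChainNonstationary Q) : ¬ FactorialSystemsSolvable Q := by
  classical
  intro hs
  choose M q hq using h
  have hM : ∀ N, N < M N := by
    intro N
    by_contra! hle
    obtain ⟨c, hc⟩ := Nat.factorial_dvd_factorial hle
    apply hq N (c • q N)
    rw [hc, mul_smul]
  let a : ℕ → ℕ := fun (k : ℕ) => M^[k] 0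
  have ha : StrictMono a := strictMono_nat_of_lt_succ fun k => by
    simpa only [a, Function.iterate_succ_apply'] using hM _
  let b : Set ℕ → ℕ → Q := fun (s : Set ℕ) (n : ℕ) => if ∃ k ∈ s, a k = n then q n else 0
  choose y hy using fun s => hs (b s)
  have hinj : ¬ Function.Injective fun s : Set ℕ => y s 0 := fun hi =>
    Cardinal.cantor ℵ₀ |>.not_ge <| by
      simpa using Cardinal.mk_le_aleph0_iff.2 hi.countable
  rw [Function.Injective] at hinj
  push Not at hinj
  obtain ⟨s, t, hst, hne⟩ := hinj
  have hex : ∃ k, ¬ (k ∈ s ↔ k ∈ t) := by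
    by_contra! hc
    exact hne (Set.ext hc)
  set k := Nat.find hex
  have hk : ¬ (k ∈ s ↔ k ∈ t) := Nat.find_spec hex
  let d : ℕ → Q := fun n => y s n - y t n
  have hd : ∀ n, n ! • d n = n ! • (b s n - b t n) + (n + 1)! • d (n + 1) := by
    intro n
    rw [← hy s n, ← hy t n, Nat.factorial_succ, mul_comm, mul_smul, ← smul_add]
    congr 1
    simp only [d]
    module
  have hbk : ∀ (s : Set ℕ) k, b s (a k) = if k ∈ s then q (a k) else 0 := by
    intro s k
    simp [b, ha.injective.eq_iff]
  have hb : ∀ n, n < a (k + 1) → n ≠ a k → b s n = b t n := by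
    intro n hn hnk
    by_cases hr : ∃ j, a j = n
    · obtain ⟨j, rfl⟩ := hr
      have hj : j < k := by
        have h1 := ha.lt_iff_lt.1 hn
        have : j ≠ k := fun h => hnk (h ▸ rfl)
        omega
      have := Nat.find_min hex hj
      rw [hbk, hbk]
      simp only [not_not] at this
      simp [this]
    · have : ∀ s : Set ℕ, b s n = 0 := fun s => by
        simp only [b]
        rw [if_neg]
        rintro ⟨k, _, hk⟩
        exact hr ⟨k, hk⟩
      rw [this, this]
  have h0 : ∀ n ≤ a k, n ! • d n = 0 := by
    intro n
    induction n with
    | zero => intro _; simp [d, hst]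
    | succ n ih =>
      intro hn
      have := hd n
      rw [ih (by omega), hb n (by have : a k < a (k + 1) := ha (Nat.lt_succ_self k); omega) (by omega)] at this
      simpa using this.symm
  have h1 : ∀ n, a k + 1 ≤ n → n ≤ a (k + 1) → (a k + 1)! • d (a k + 1) = n ! • d n := by
    intro n hn
    induction n, hn using Nat.le_induction with
    | base => intro _; rfl
    | succ n hn ih =>
      intro hn'
      rw [ih (by omega), hd n, hb n (by omega) (by omega)]
      simp
  have hak : a (k + 1) = M (a k) := Function.iterate_succ_apply' _ _ _
  have h2 := hd (a k)
  rw [h0 _ le_rfl, h1 _ (hak ▸ hM _) le_rfl, hbk, hbk, hak] at h2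
  by_cases hks : k ∈ s
  · have hkt : k ∉ t := by tauto
    rw [if_pos hks, if_neg hkt, sub_zero] at h2
    apply hq (a k) (- d (M (a k)))
    rw [smul_neg]
    exact eq_neg_of_add_eq_zero_left h2.symm
  · have hkt : k ∈ t := by tauto
    rw [if_neg hks, if_pos hkt, zero_sub, smul_neg] at h2
    apply hq (a k) (d (M (a k)))
    exact (neg_add_eq_zero.1 h2.symm)

/-- If the chain stops at `N`, then `N! T` is divisible. The sums of the first `N` terms of the
formal solution solve the system up to errors in `N! T`, because `N!` divides a product of `N`
consecutive integers; the errors are solved recursively inside `N! T`. -/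
lemma factorialSystemsSolvable_of_stationary {T : Type*} [AddCommGroup T]
    (h : ¬ FactorialChainNonstationary T) : FactorialSystemsSolvable T := by
  intro b
  simp only [FactorialChainNonstationary] at h
  push Not at h
  obtain ⟨N, hN⟩ := h
  have hdiv : ∀ (d : {d : T // ∃ q, d = N ! • q}) (m : ℕ),
      ∃ e : {d : T // ∃ q, d = N ! • q}, (m + 1) • e.1 = d.1 := by
    rintro ⟨d, q, rfl⟩ m
    obtain ⟨q', hq'⟩ := hN (N + (m + 1)) q
    obtain ⟨c, hc⟩ := Nat.factorial_mul_factorial_dvd_factorial_add N (m + 1)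
    refine ⟨⟨N ! • (m ! * c) • q', _, rfl⟩, ?_⟩
    change (m + 1) • N ! • (m ! * c) • q' = N ! • q
    rw [hq', hc, ← mul_smul, ← mul_smul, Nat.factorial_succ]
    congr 1
    ring
  choose g hg using hdiv
  have hdvd : ∀ n, ∃ e : T, (n + 1).ascFactorial N • b (n + N) = N ! • e := fun n => by
    obtain ⟨c, hc⟩ := Nat.factorial_dvd_ascFactorial (n + 1) N
    exact ⟨c • b (n + N), by rw [hc, mul_smul]⟩
  choose e he using hdvd
  let z : ℕ → {d : T // ∃ q, d = N ! • q} := fun n =>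
    Nat.rec ⟨0, 0, by simp⟩ (fun n w => g ⟨w.1 - N ! • e n, by
      obtain ⟨q, hq⟩ := w.2
      exact ⟨q - e n, by rw [hq, smul_sub]⟩⟩ n) n
  have hz : ∀ n, (n + 1) • (z (n + 1)).1 = (z n).1 - N ! • e n := fun n => hg _ _
  let y : ℕ → T := fun n => ∑ j ∈ Finset.range N, (n + 1).ascFactorial j • b (n + j)
  have hy : ∀ n, (n + 1) • y (n + 1) + b n = y n + N ! • e n := fun n => by
    rw [← he]
    simp only [y]
    rw [← Finset.sum_range_succ, Finset.sum_range_succ', Finset.smul_sum]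
    simp only [Nat.ascFactorial_zero, one_smul, add_zero]
    congr 1
    refine Finset.sum_congr rfl fun j _ => ?_
    rw [← mul_smul, Nat.succ_ascFactorial, Nat.ascFactorial_succ, add_right_comm, add_assoc n j 1]
  refine ⟨fun n => y n + (z n).1, fun n => ?_⟩
  simp only [smul_add, hz n]
  rw [eq_sub_of_add_eq (hy n)]
  abel

/-- A torsion group with nonstationary chain `n! T` has a countable quotient with that property. -/
lemma exists_countable_quotient_of_torsion {T : Type*} [AddCommGroup T] (hT : IsAddTorsion T)
    (h : FactorialChainNonstationary T) :
    ∃ K : AddSubgroup T, Countable (T ⧸ K) ∧ FactorialChainNonstationary (T ⧸ K) := by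
  classical
  have hchar : ∀ k : ℕ, ∃ (χ : T →+ AddCircle (1 : ℚ)) (n : ℕ) (s : T),
      (∀ t, χ (n ! • t) = 0) ∧ χ (k ! • k ! • s) ≠ 0 := by
    intro k
    -- `k! * k!` divides `(k + k)!`. One factor is used to make `Φ` below finitely supported, the
    -- other to test the chain at `k`.
    obtain ⟨M, q, hq⟩ := h (k + k)
    obtain ⟨c, hc⟩ := Nat.factorial_mul_factorial_dvd_factorial_add k k
    let K := (nsmulAddMonoidHom (α := T) M !).range
    have hne : (QuotientAddGroup.mk' K) (k ! • k ! • c • q) ≠ 0 := by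
      rw [← mul_smul, ← mul_smul, ← hc]
      intro h0
      obtain ⟨q', hq'⟩ := (QuotientAddGroup.eq_zero_iff _).1 h0
      exact hq q' hq'.symm
    obtain ⟨χ, hχ⟩ := CharacterModule.exists_character_apply_ne_zero_of_ne_zero hne
    refine ⟨AddMonoidHom.comp χ (QuotientAddGroup.mk' K), M, c • q, fun t => ?_, hχ⟩
    have : (QuotientAddGroup.mk' K) (M ! • t) = 0 := (QuotientAddGroup.eq_zero_iff _).2 ⟨t, rfl⟩
    change χ (QuotientAddGroup.mk' K (M ! • t)) = 0
    rw [this, map_zero]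
  choose χ n s hχ hs using hchar
  have hfin : ∀ t : T, ∃ m, ∀ k ≥ m, k ! • t = 0 := fun t => by
    obtain ⟨m, hm, hmt⟩ := isOfFinAddOrder_iff_nsmul_eq_zero.1 (hT t)
    refine ⟨m, fun k hk => ?_⟩
    obtain ⟨c, hc⟩ := Nat.dvd_factorial hm hk
    rw [hc, mul_comm, mul_smul, hmt, smul_zero]
  -- For torsion `t` almost all `k! • t` vanish, so the image of `Φ` lies in a countable group.
  let Φ : T →+ (ℕ →₀ AddCircle (1 : ℚ)) :=
    { toFun := fun t => Finsupp.ofSupportFinite (fun k => χ k (k ! • t)) (by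
        obtain ⟨m, hm⟩ := hfin t
        refine (Set.finite_Iio m).subset fun k hk => ?_
        by_contra hc
        exact hk (by simp [hm k (by simpa using hc)]))
      map_zero' := by
        ext k
        change χ k (k ! • 0) = 0
        simp
      map_add' := fun x y => by
        ext k
        change χ k (k ! • (x + y)) = χ k (k ! • x) + χ k (k ! • y)
        simp }
  have hΦ : ∀ t k, Φ t k = χ k (k ! • t) := fun t k => rfl
  refine ⟨Φ.ker, ?_, ?_⟩
  · have : Countable (AddCircle (1 : ℚ)) := (QuotientAddGroup.mk_surjective).countable
    exact (QuotientAddGroup.kerLift_injective Φ).countable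
  · intro N
    refine ⟨n N, QuotientAddGroup.mk (s N), fun q' hq' => ?_⟩
    obtain ⟨t, rfl⟩ := QuotientAddGroup.mk_surjective q'
    have h1 : Φ (N ! • s N) = Φ ((n N)! • t) := congrArg (QuotientAddGroup.kerLift Φ) hq'
    have h2 := DFunLike.congr_fun h1 N
    rw [hΦ, hΦ, smul_comm N ! (n N)!, hχ] at h2
    exact hs N h2

end FactorialSystems

/-! ### Ladders on non-reflecting sets, and diamond -/

section Ladders
open Ordinal Order Set

lemma exists_strictMono_cofinal_of_cof_eq_aleph0 {δ : Ordinal.{u}} (h : δ.cof = ℵ₀) :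
    ∃ f : ℕ → Ordinal.{u}, StrictMono f ∧ (∀ n, f n < δ) ∧ ∀ β < δ, ∃ n, β ≤ f n := by
  obtain ⟨f, hf⟩ := exists_isFundamentalSeq (o := δ) (a := ω) (by rw [h, ord_aleph0])
  refine ⟨fun n => f ⟨n, natCast_lt_omega0 n⟩, fun m n hmn => ?_, fun n => (f _).2, fun β hβ => ?_⟩
  · exact hf.strictMono (Subtype.mk_lt_mk.2 (Nat.cast_lt.2 hmn))
  · obtain ⟨_, ⟨⟨c, hc⟩, rfl⟩, hcβ⟩ := hf.isCofinal_range ⟨β, hβ⟩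
    obtain ⟨n, rfl⟩ := lt_omega0.1 hc
    exact ⟨n, hcβ⟩

/-- A cofinal subset of `j` none of whose limit points below `j` lies in `S`. -/
lemma exists_cofinal_without_limit_points_in {S : Set Ordinal.{u}} {j : Ordinal.{u}}
    (h0 : ∀ δ ∈ S, 0 < δ) (hj : ℵ₀ < j.cof → ¬ StationaryIn S j) :
    ∃ C : Set Ordinal.{u}, (∀ c ∈ C, c < j) ∧ (∀ δ < j, ∃ c ∈ C, δ ≤ c) ∧
      ∀ δ ∈ S, δ < j → ∃ ε < δ, ∀ c ∈ C, c < δ → c ≤ ε := by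
  rcases lt_trichotomy j.cof ℵ₀ with hlt | heq | hgt
  · rw [Ordinal.cof_lt_aleph0_iff, Cardinal.le_one_iff, Ordinal.cof_eq_zero,
      Ordinal.cof_eq_one_iff] at hlt
    rcases hlt with rfl | ⟨i, rfl⟩
    · exact ⟨∅, by simp, by simp, by simp⟩
    · refine ⟨{i}, by simp, fun δ hδ => ⟨i, rfl, Order.lt_succ_iff.1 hδ⟩, fun δ hδS hδ => ?_⟩
      refine ⟨0, h0 δ hδS, ?_⟩
      rintro _ rfl hi
      exact absurd hi (Order.lt_succ_iff.1 hδ).not_gt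
  · obtain ⟨f, hf, hfj, hcof⟩ := exists_strictMono_cofinal_of_cof_eq_aleph0 heq
    refine ⟨range f, by rintro _ ⟨n, rfl⟩; exact hfj n, fun δ hδ => ?_, fun δ hδS hδ => ?_⟩
    · obtain ⟨n, hn⟩ := hcof δ hδ
      exact ⟨_, ⟨n, rfl⟩, hn⟩
    · obtain ⟨n, hn⟩ := hcof δ hδ
      have hfin : ((f '' Iio n) ∩ Iio δ).Finite := ((finite_Iio n).image f).inter_of_left _
      rcases ((f '' Iio n) ∩ Iio δ).eq_empty_or_nonempty with he | hne
      · refine ⟨0, h0 δ hδS, ?_⟩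
        rintro _ ⟨m, rfl⟩ hm
        have : f m ∈ (f '' Iio n) ∩ Iio δ := ⟨⟨m, hf.lt_iff_lt.1 (hm.trans_le hn), rfl⟩, hm⟩
        rw [he] at this
        exact this.elim
      · obtain ⟨ε, hε, hmax⟩ := hfin.exists_maximal hne
        refine ⟨ε, hε.2, ?_⟩
        rintro _ ⟨m, rfl⟩ hm
        have : f m ∈ (f '' Iio n) ∩ Iio δ := ⟨⟨m, hf.lt_iff_lt.1 (hm.trans_le hn), rfl⟩, hm⟩
        exact (le_total (f m) ε).elim id fun h => hmax this h
  -- In uncountable cofinality `C` is a club disjoint from `S`; a limit point of it in `S` below `j`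
  -- would belong to it.
  · obtain ⟨C, hC, hdisj⟩ := not_isStationary_iff.1 (hj hgt)
    refine ⟨Subtype.val '' C, ?_, fun δ hδ => ?_, fun δ hδS hδ => ?_⟩
    · rintro _ ⟨c, _, rfl⟩
      exact c.2
    · obtain ⟨c, hc, hle⟩ := hC.isCofinal ⟨δ, hδ⟩
      exact ⟨_, ⟨c, hc, rfl⟩, hle⟩
    · by_contra! hcon
      refine Set.disjoint_left.1 hdisj (show (⟨δ, hδ⟩ : Iio j) ∈ _ from hδS)
        (hC.isLUB_mem (t := {c : Iio j | c ∈ C ∧ c.1 < δ}) (fun c hc => hc.1) ?_ ?_)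
      · obtain ⟨_, ⟨c, hc, rfl⟩, hcδ, -⟩ := hcon 0 (h0 δ hδS)
        exact ⟨c, ⟨hc, hcδ⟩⟩
      · refine ⟨fun c hc => hc.2.le, fun b hb => ?_⟩
        by_contra! hbδ
        obtain ⟨_, ⟨c, hc, rfl⟩, hcδ, hbc⟩ := hcon b hbδ
        exact (hb ⟨hc, hcδ⟩).not_gt hbc

/-- Ladders on a non-reflecting set have pairwise disjoint tails below every `j < κ`. -/
lemma exists_disjoint_tails {S : Set Ordinal.{u}} {κ : Ordinal.{u}} (hS : NonReflectingIn S κ)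
    (η : Ordinal.{u} → ℕ → Ordinal.{u}) (hmono : ∀ δ ∈ S, StrictMono (η δ))
    (hlt : ∀ δ ∈ S, ∀ n, η δ n < δ) (hcof : ∀ δ ∈ S, ∀ β < δ, ∃ n, β ≤ η δ n) :
    ∀ j < κ, ∃ h : Ordinal.{u} → ℕ, ∀ δ ∈ S, ∀ δ' ∈ S, δ ≤ j → δ' ≤ j → δ ≠ δ' →
      ∀ n ≥ h δ, ∀ m ≥ h δ', η δ n ≠ η δ' m := by
  have h0 : ∀ δ ∈ S, 0 < δ := fun δ hδ => (hlt δ hδ 0).bot_lt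
  intro j
  induction j using WellFoundedLT.induction with
  | ind j ih =>
  intro hjκ
  obtain ⟨C, hCj, hCcof, hCS⟩ := exists_cofinal_without_limit_points_in h0 (hS j hjκ)
  -- tails below `j`
  have hbelow : ∃ h : Ordinal.{u} → ℕ, ∀ δ ∈ S, ∀ δ' ∈ S, δ < δ' → δ' < j →
      ∀ n ≥ h δ, ∀ m ≥ h δ', η δ n ≠ η δ' m := by
    -- `N δ` is the least element of `C` above or equal to `δ`. Ordinals with the same `N` are
    -- separated by the induction hypothesis at `N δ`; otherwise the later ladder is cut so as to
    -- start above `N δ`.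
    have hN : ∀ δ, ∃ c, δ < j → c ∈ C ∧ δ ≤ c ∧ ∀ d ∈ C, δ ≤ d → c ≤ d := fun δ => by
      by_cases hδ : δ < j
      · obtain ⟨c, hc, hδc⟩ := hCcof δ hδ
        have hne : {c | c ∈ C ∧ δ ≤ c}.Nonempty := ⟨c, hc, hδc⟩
        obtain ⟨h1, h2⟩ := csInf_mem hne
        exact ⟨_, fun _ => ⟨h1, h2, fun d hd hδd => csInf_le' ⟨hd, hδd⟩⟩⟩
      · exact ⟨0, fun h => absurd h hδ⟩
    choose N hN using hN
    have hg : ∀ c, ∃ h : Ordinal.{u} → ℕ, c ∈ C → ∀ δ ∈ S, ∀ δ' ∈ S, δ ≤ c → δ' ≤ c → δ ≠ δ' →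
        ∀ n ≥ h δ, ∀ m ≥ h δ', η δ n ≠ η δ' m := fun c => by
      by_cases hc : c ∈ C
      · obtain ⟨h, hh⟩ := ih c (hCj c hc) ((hCj c hc).trans hjκ)
        exact ⟨h, fun _ => hh⟩
      · exact ⟨0, fun h => absurd h hc⟩
    choose g hg using hg
    have ht : ∀ δ, ∃ k, δ ∈ S → δ < j → ∀ n ≥ k, ∀ c ∈ C, c < δ → c < η δ n := fun δ => by
      by_cases hδ : δ ∈ S ∧ δ < j
      · obtain ⟨ε, hε, hεC⟩ := hCS δ hδ.1 hδ.2
        obtain ⟨k, hk⟩ := hcof δ hδ.1 ε hε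
        refine ⟨k + 1, fun _ _ n hn c hc hcδ => ((hεC c hc hcδ).trans hk).trans_lt ?_⟩
        exact hmono δ hδ.1 (by omega)
      · exact ⟨0, fun h1 h2 => absurd ⟨h1, h2⟩ hδ⟩
    choose t ht using ht
    refine ⟨fun δ => max (g (N δ) δ) (t δ), fun δ hδ δ' hδ' hδδ' hδ'j n hn m hm => ?_⟩
    obtain ⟨h1, h2, h3⟩ := hN δ (hδδ'.trans hδ'j)
    obtain ⟨h1', h2', h3'⟩ := hN δ' hδ'j
    by_cases hNN : N δ = N δ'
    · refine hg (N δ) h1 δ hδ δ' hδ' h2 (hNN ▸ h2') hδδ'.ne n (le_of_max_le_left hn) m ?_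
      rw [hNN]
      exact le_of_max_le_left hm
    · have hlt' : N δ < δ' := by
        by_contra! hle
        exact hNN ((h3 _ h1' (hδδ'.le.trans h2')).antisymm (h3' _ h1 hle))
      exact (((hlt δ hδ n).trans_le h2).trans
        (ht δ' hδ' hδ'j m (le_of_max_le_right hm) _ h1 hlt')).ne
  obtain ⟨h, hh⟩ := hbelow
  -- avoid the ladder of `j`
  have ha : ∀ δ, ∃ k, δ ∈ S → j ∈ S → δ < j → ∀ n ≥ k, ∀ m, η δ n ≠ η j m := fun δ => by
    by_cases hδ : δ ∈ S ∧ j ∈ S ∧ δ < j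
    · obtain ⟨h1, h2, h3⟩ := hδ
      obtain ⟨m₀, hm₀⟩ := hcof j h2 δ h3
      have : ∀ M : ℕ, ∃ k, ∀ n ≥ k, ∀ m < M, η δ n ≠ η j m := fun M => by
        induction M with
        | zero => exact ⟨0, by simp⟩
        | succ M ihM =>
          obtain ⟨k, hk⟩ := ihM
          have : ∃ k', ∀ n ≥ k', η δ n ≠ η j M := by
            by_cases hM : η j M < δ
            · obtain ⟨k', hk'⟩ := hcof δ h1 _ hM
              exact ⟨k' + 1, fun n hn => (hk'.trans_lt (hmono δ h1 (by omega))).ne'⟩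
            · exact ⟨0, fun n _ => ((hlt δ h1 n).trans_le (not_lt.1 hM)).ne⟩
          obtain ⟨k', hk'⟩ := this
          refine ⟨max k k', fun n hn m hm => ?_⟩
          rcases Nat.lt_succ_iff_lt_or_eq.1 hm with hm | rfl
          · exact hk n (le_of_max_le_left hn) m hm
          · exact hk' n (le_of_max_le_right hn)
      obtain ⟨k, hk⟩ := this m₀
      refine ⟨k, fun _ _ _ n hn m => ?_⟩
      rcases lt_or_ge m m₀ with hm | hm
      · exact hk n hn m hm
      · exact (((hlt δ h1 n).trans_le hm₀).trans_le ((hmono j h2).monotone hm)).ne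
    · exact ⟨0, fun h1 h2 h3 => absurd ⟨h1, h2, h3⟩ hδ⟩
  choose a ha using ha
  have hmain : ∀ δ ∈ S, ∀ δ' ∈ S, δ < δ' → δ' ≤ j →
      ∀ n ≥ max (h δ) (a δ), ∀ m ≥ max (h δ') (a δ'), η δ n ≠ η δ' m := by
    intro δ hδ δ' hδ' hlt' hle n hn m hm
    rcases hle.lt_or_eq with hj | rfl
    · exact hh δ hδ δ' hδ' hlt' hj n (le_of_max_le_left hn) m (le_of_max_le_left hm)
    · exact ha δ hδ hδ' hlt' n (le_of_max_le_right hn) m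
  refine ⟨fun δ => max (h δ) (a δ), fun δ hδ δ' hδ' hδj hδ'j hne n hn m hm => ?_⟩
  rcases hne.lt_or_gt with hlt' | hlt'
  · exact hmain δ hδ δ' hδ' hlt' hδ'j n hn m hm
  · exact (hmain δ' hδ' δ hδ hlt' hδj m hm n hn).symm

/-- The closure points of `h` form a club: unboundedness follows by iterating a bound for `h` on
initial segments ω times, which stays below `γ` by regularity and uncountability. -/
lemma StationaryIn.exists_closed_under {S : Set Ordinal.{u}} {γ : Cardinal.{u}}
    (hγ : γ.IsRegular) (hγ0 : ℵ₀ < γ) (hS : StationaryIn S γ.ord)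
    (h : Ordinal.{u} → Ordinal.{u}) (hh : ∀ α < γ.ord, h α < γ.ord) :
    ∃ δ ∈ S, δ < γ.ord ∧ ∀ α < δ, h α < δ := by
  have hclub : IsClub {δ : Iio γ.ord | ∀ α < δ.1, h α < δ.1} := by
    constructor
    · intro d hd _ _ a ha α hα
      obtain ⟨x, hx, hαx⟩ := (lt_isLUB_iff ha).1 (show (⟨α, hα.trans a.2⟩ : Iio γ.ord) < a from hα)
      exact (hd hx α hαx).trans_le (ha.1 hx)
    · rintro ⟨a, ha⟩
      let F : Ordinal.{u} → Ordinal.{u} := fun β =>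
        max β (⨆ α : β.ToType, h (ToType.toOrd α).1 + 1)
      have hF : ∀ β < γ.ord, F β < γ.ord := fun β hβ => by
        refine max_lt hβ (iSup_add_one_lt_of_lt_cof ?_ fun i =>
          hh _ ((ToType.toOrd i).2.trans hβ))
        rw [mk_toType, hγ.cof_ord]
        exact lt_ord.1 hβ
      have hcof : ℵ₀ < γ.ord.cof := by rwa [hγ.cof_ord]
      refine ⟨⟨nfp F a, nfp_lt_ord hcof hF ha⟩, fun α hα => ?_, le_nfp F a⟩
      obtain ⟨n, hn⟩ := lt_nfp_iff.1 hα
      refine lt_of_lt_of_le ?_ (iterate_le_nfp F a (n + 1))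
      rw [Function.iterate_succ_apply']
      refine lt_of_lt_of_le ?_ (le_max_right _ _)
      have := Ordinal.le_iSup (fun i : (F^[n] a).ToType => h (ToType.toOrd i).1 + 1)
        (ToType.mk ⟨α, hn⟩)
      simp only [ToType.toOrd, OrderIso.symm_apply_apply] at this
      exact lt_of_lt_of_le (lt_add_one _) this
  obtain ⟨δ, hδS, hδ⟩ := hS hclub
  exact ⟨δ, hδS, δ.2, hδ⟩

/-- Diamond for functions: on a stationary subset of `S`, the guesses agree with a given function
into a set of size at most `γ`. -/
lemma DiamondOn.exists_guesses {S : Set Ordinal.{u}} {γ : Cardinal.{u}} (hγ : γ.IsRegular)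
    (hγ0 : ℵ₀ < γ) (h : DiamondOn S γ.ord) (B : Type u) [Nonempty B] (hB : #B ≤ γ) :
    ∃ g : Ordinal.{u} → Ordinal.{u} → B, ∀ f : Ordinal.{u} → B,
      ∃ δ ∈ S, δ < γ.ord ∧ ∀ α < δ, g δ α = f α := by
  classical
  obtain ⟨A, hA, hguess⟩ := h
  obtain ⟨e, he⟩ : ∃ e : γ.ord.ToType × B → γ.ord.ToType, Function.Injective e := by
    have : #(γ.ord.ToType × B) ≤ #γ.ord.ToType := by
      rw [mk_prod, Cardinal.lift_id, Cardinal.lift_id, mk_toType, card_ord]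
      exact (mul_le_mul_right hB γ).trans (mul_eq_self hγ.aleph0_le).le
    obtain ⟨e⟩ := this
    exact ⟨e, e.injective⟩
  let code : Ordinal.{u} → B → Ordinal.{u} := fun α b =>
    if hα : α < γ.ord then (ToType.toOrd (e (ToType.mk ⟨α, hα⟩, b))).1 else 0
  have hcode_lt : ∀ α b, code α b < γ.ord := fun α b => by
    by_cases hα : α < γ.ord
    · simp only [code, dif_pos hα]
      exact (ToType.toOrd _).2
    · simp only [code, dif_neg hα]
      exact hγ.ord_pos
  have hcode_inj : ∀ α α' b b', α < γ.ord → α' < γ.ord → code α b = code α' b' →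
      α = α' ∧ b = b' := by
    intro α α' b b' hα hα' heq
    simp only [code, dif_pos hα, dif_pos hα'] at heq
    have := he (ToType.mk.symm.injective (Subtype.ext heq))
    obtain ⟨h1, h2⟩ := Prod.ext_iff.1 this
    exact ⟨congrArg Subtype.val (ToType.mk.injective h1), h2⟩
  refine ⟨fun δ α => if hb : ∃ b, code α b ∈ A δ then hb.choose else Classical.arbitrary B,
    fun f => ?_⟩
  -- `X` codes the graph of `f`. At a guessing point `δ` closed under `α ↦ code α (f α)`, the set `A
  -- δ` contains the codes of all `f α` with `α < δ`, and injectivity of the code lets `f α` be read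
  -- off.
  let X : Set Ordinal.{u} := {x | ∃ α < γ.ord, x = code α (f α)}
  have hX : X ⊆ Iio γ.ord := by
    rintro _ ⟨α, _, rfl⟩
    exact hcode_lt _ _
  obtain ⟨δ, ⟨hδS, hδX⟩, hδ, hclosed⟩ := (hguess X hX).exists_closed_under hγ hγ0
    (fun α => code α (f α)) fun α _ => hcode_lt _ _
  refine ⟨δ, hδS, hδ, fun α hα => ?_⟩
  have hex : ∃ b, code α b ∈ A δ :=
    ⟨f α, hδX ▸ ⟨⟨α, hα.trans hδ, rfl⟩, hclosed α hα⟩⟩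
  simp only [dif_pos hex]
  have hmem := hex.choose_spec
  obtain ⟨⟨α', hα', heq⟩, _⟩ : code α hex.choose ∈ X ∩ Iio δ := hδX.symm ▸ hmem
  obtain ⟨h1, h2⟩ := hcode_inj _ _ _ _ (hα.trans hδ) hα' heq
  rw [h2, h1]

end Ladders

/-! ### Submodules of free modules over a principal ideal domain -/

section SubmoduleFree

/-- A submodule of a free module over a principal ideal domain is free. -/
lemma Finsupp.free_submodule {R ι : Type*} [CommRing R] [IsDomain R] [IsPrincipalIdealRing R]
    (N : Submodule R (ι →₀ R)) : Module.Free R N := by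
  classical
  obtain ⟨_, _⟩ := exists_wellFoundedLT ι
  -- With `ι` well-ordered, `b i` has as leading coefficient a generator of the ideal of `i`-th
  -- coefficients of elements of `N` supported up to `i`. Those with nonzero leading coefficient
  -- form a basis.
  have hb : ∀ i : ι, ∃ b ∈ N ⊓ supported R R (Set.Iic i),
      ∀ v ∈ N ⊓ supported R R (Set.Iic i), ∃ k, v i = k * b i := fun i => by
    let J : Ideal R := (N ⊓ supported R R (Set.Iic i)).map (lapply (R := R) i)
    obtain ⟨b, hb, hbi⟩ := Submodule.IsPrincipal.generator_mem J
    refine ⟨b, hb, fun v hv => ?_⟩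
    have : v i ∈ J := ⟨v, hv, rfl⟩
    obtain ⟨k, hk⟩ := (Submodule.IsPrincipal.mem_iff_eq_smul_generator J).1 this
    refine ⟨k, ?_⟩
    rw [hk, ← hbi]
    rfl
  choose b hbN hb using hb
  have hsupp : ∀ i j, i < j → b i j = 0 := fun i j hij => by
    by_contra h
    exact ((mem_supported R _).1 (hbN i).2 (mem_support_iff.2 h)).not_gt hij
  let f : {i // b i i ≠ 0} → N := fun i => ⟨b i, (hbN i).1⟩
  have hli : LinearIndependent R f := by
    refine (injective_iff_map_eq_zero (linearCombination R f)).2 fun c hc => ?_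
    by_contra hne
    have hne' : c.support.Nonempty := support_nonempty_iff.2 hne
    set m := c.support.max' hne' with hm
    have hmem : m ∈ c.support := c.support.max'_mem hne'
    have h1 := congrArg (fun v : N => (v : ι →₀ R) m) hc
    simp only [linearCombination_apply, Finsupp.sum, f, AddSubmonoidClass.coe_finsetSum,
      Submodule.coe_smul, finsetSum_apply, coe_smul, Pi.smul_apply, ZeroMemClass.coe_zero, coe_zero,
      Pi.zero_apply] at h1
    rw [Finset.sum_eq_single m] at h1
    · rcases smul_eq_zero.1 h1 with h | h
      · exact mem_support_iff.1 hmem h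
      · exact m.2 h
    · intro i hi him
      have : i < m := lt_of_le_of_ne (c.support.le_max' i hi) him
      rw [hsupp i m this, smul_zero]
    · exact fun h => absurd hmem h
  have hspan : ∀ i, ∀ v : N, (v : ι →₀ R) ∈ supported R R (Set.Iic i) →
      v ∈ Submodule.span R (Set.range f) := by
    intro i
    induction i using WellFoundedLT.induction with
    | ind i ih =>
    intro v hv
    obtain ⟨k, hk⟩ := hb i v ⟨v.2, hv⟩
    have key : ∀ w : N, (w : ι →₀ R) ∈ supported R R (Set.Iic i) → (w : ι →₀ R) i = 0 →
        w ∈ Submodule.span R (Set.range f) := by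
      intro w hw hwi
      rcases (w : ι →₀ R).support.eq_empty_or_nonempty with h0 | hne
      · have : w = 0 := Subtype.ext (support_eq_empty.1 h0)
        rw [this]
        exact zero_mem _
      · refine ih ((w : ι →₀ R).support.max' hne) ?_ w fun j hj =>
          Finset.le_max' (w : ι →₀ R).support j hj
        have hmem := (w : ι →₀ R).support.max'_mem hne
        refine lt_of_le_of_ne (hw hmem) fun h => ?_
        rw [h] at hmem
        exact mem_support_iff.1 hmem hwi
    by_cases hbi : b i i = 0
    · exact key v hv (by rw [hk, hbi, mul_zero])
    · have hf : k • f ⟨i, hbi⟩ ∈ Submodule.span R (Set.range f) :=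
        Submodule.smul_mem _ _ (Submodule.subset_span ⟨_, rfl⟩)
      rw [← sub_add_cancel v (k • f ⟨i, hbi⟩)]
      refine add_mem (key _ (sub_mem hv (Submodule.smul_mem _ _ (hbN i).2)) ?_) hf
      simp [f, hk]
  refine Module.Free.of_basis (Module.Basis.mk hli fun v _ => ?_)
  rcases (v : ι →₀ R).support.eq_empty_or_nonempty with h0 | hne
  · have : v = 0 := Subtype.ext (support_eq_empty.1 h0)
    rw [this]
    exact zero_mem _
  · exact hspan ((v : ι →₀ R).support.max' hne) v fun j hj =>
      Finset.le_max' (v : ι →₀ R).support j hj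

lemma Module.Free.of_injective_addMonoidHom {A M : Type*} [AddCommGroup A] [AddCommGroup M]
    [Module.Free ℤ M] (f : A →+ M) (hf : Function.Injective f) : Module.Free ℤ A := by
  let e := Module.Free.chooseBasis ℤ M |>.repr
  let g := e.toLinearMap ∘ₗ f.toIntLinearMap
  have hg : Function.Injective g := e.injective.comp hf
  have := Finsupp.free_submodule (LinearMap.range g)
  exact Module.Free.of_equiv (LinearEquiv.ofInjective g hg).symm

end SubmoduleFree

/-! ### Generators, relators and the retraction -/

section LadderGroup
variable {W : Type u}

/-- The generator `x w`. -/
noncomputable def ladderX (w : W) : (W ⊕ W × ℕ) →₀ ℤ := Finsupp.single (Sum.inl w) 1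

/-- The generator `y w n`. -/
noncomputable def ladderY (w : W) (n : ℕ) : (W ⊕ W × ℕ) →₀ ℤ := Finsupp.single (Sum.inr (w, n)) 1

/-- The relator `x (η w n) - y w n + (n + 1) y w (n + 1)`. -/
noncomputable def ladderRel (η : W → ℕ → W) (w : W) (n : ℕ) : (W ⊕ W × ℕ) →₀ ℤ :=
  ladderX (η w n) - ladderY w n + (n + 1) • ladderY w (n + 1)

/-- The element of `W` to which a generator belongs. -/
def ladderIndex : W ⊕ W × ℕ → W := Sum.elim id Prod.fst

/-- The span of all generators belonging to elements of `D`. -/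
noncomputable def genSpan (D : Set W) : Submodule ℤ ((W ⊕ W × ℕ) →₀ ℤ) :=
  Finsupp.supported ℤ ℤ (ladderIndex ⁻¹' D)

/-- The span of all relators belonging to elements of `D`. -/
noncomputable def relSpan (η : W → ℕ → W) (D : Set W) : Submodule ℤ ((W ⊕ W × ℕ) →₀ ℤ) :=
  Submodule.span ℤ ((fun p : W × ℕ => ladderRel η p.1 p.2) '' {p | p.1 ∈ D})

lemma ladderX_mem_genSpan {D : Set W} {w : W} (hw : w ∈ D) : ladderX w ∈ genSpan D :=
  Finsupp.single_mem_supported ℤ _ hw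

lemma ladderY_mem_genSpan {D : Set W} {w : W} (hw : w ∈ D) (n : ℕ) : ladderY w n ∈ genSpan D :=
  Finsupp.single_mem_supported ℤ _ hw

lemma genSpan_induction {D : Set W} {p : ((W ⊕ W × ℕ) →₀ ℤ) → Prop} (h0 : p 0)
    (hadd : ∀ v w, p v → p w → p (v + w)) (hsmul : ∀ (a : ℤ) v, p v → p (a • v))
    (hx : ∀ w ∈ D, p (ladderX w)) (hy : ∀ w ∈ D, ∀ n, p (ladderY w n)) {v} (hv : v ∈ genSpan D) :
    p v := by
  rw [genSpan, Finsupp.supported_eq_span_single] at hv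
  induction hv using Submodule.span_induction with
  | mem v hv =>
    obtain ⟨i | i, hi, rfl⟩ := hv
    · exact hx i hi
    · exact hy i.1 hi i.2
  | zero => exact h0
  | add v w _ _ hv hw => exact hadd v w hv hw
  | smul a v _ hv => exact hsmul a v hv

lemma genSpan_univ : genSpan (Set.univ : Set W) = ⊤ := by
  simp [genSpan, Finsupp.supported_univ]

lemma genSpan_empty : genSpan (∅ : Set W) = ⊥ := by
  simp [genSpan]

lemma genSpan_mono {D D' : Set W} (h : D ⊆ D') : genSpan D ≤ genSpan D' :=
  Finsupp.supported_mono fun _ hi => h hi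

lemma relSpan_mono (η : W → ℕ → W) {D D' : Set W} (h : D ⊆ D') : relSpan η D ≤ relSpan η D' :=
  Submodule.span_mono (Set.image_mono fun _ hp => h hp)

lemma ladderRel_mem_relSpan (η : W → ℕ → W) {D : Set W} {w : W} (hw : w ∈ D) (n : ℕ) :
    ladderRel η w n ∈ relSpan η D :=
  Submodule.subset_span ⟨(w, n), hw, rfl⟩

lemma relSpan_le {η : W → ℕ → W} {D : Set W} {U : Submodule ℤ ((W ⊕ W × ℕ) →₀ ℤ)}
    (h : ∀ w ∈ D, ∀ n, ladderRel η w n ∈ U) : relSpan η D ≤ U := by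
  refine Submodule.span_le.2 ?_
  rintro _ ⟨p, hp, rfl⟩
  exact h p.1 hp p.2

lemma ladderRel_mem_genSpan {η : W → ℕ → W} {D : Set W} {w : W} (hw : w ∈ D) (n : ℕ)
    (hη : η w n ∈ D) : ladderRel η w n ∈ genSpan D :=
  add_mem (sub_mem (ladderX_mem_genSpan hη) (ladderY_mem_genSpan hw n))
    (nsmul_mem (ladderY_mem_genSpan hw (n + 1)) _)

/-- The linear map with prescribed values on the generators. -/
noncomputable def ladderLift {V : Type*} [AddCommGroup V] (X : W → V) (Y : W → ℕ → V) :
    ((W ⊕ W × ℕ) →₀ ℤ) →ₗ[ℤ] V :=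
  Finsupp.linearCombination ℤ (Sum.elim X fun p => Y p.1 p.2)

@[simp] lemma ladderLift_X {V : Type*} [AddCommGroup V] (X : W → V) (Y : W → ℕ → V) (w : W) :
    ladderLift X Y (ladderX w) = X w := by
  simp [ladderLift, ladderX]

@[simp] lemma ladderLift_Y {V : Type*} [AddCommGroup V] (X : W → V) (Y : W → ℕ → V) (w : W)
    (n : ℕ) : ladderLift X Y (ladderY w n) = Y w n := by
  simp [ladderLift, ladderY]

lemma map_ladderRel {V : Type*} [AddCommGroup V] (L : ((W ⊕ W × ℕ) →₀ ℤ) →ₗ[ℤ] V)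
    (η : W → ℕ → W) (w : W) (n : ℕ) :
    L (ladderRel η w n) = L (ladderX (η w n)) - L (ladderY w n) + (n + 1) • L (ladderY w (n + 1)) := by
  simp only [ladderRel, map_add, map_sub, map_nsmul]

/-- Over a divisible torsion-free group the `y`-values can be chosen such that the relators take
prescribed values. -/
lemma exists_lift_of_rat {V : Type*} [AddCommGroup V] [Module ℚ V] (η : W → ℕ → W) (D : Set W)
    (X : W → V) (Y : W → ℕ → V) (b : W → ℕ → V) :
    ∃ L : ((W ⊕ W × ℕ) →₀ ℤ) →ₗ[ℤ] V, (∀ w, L (ladderX w) = X w) ∧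
      (∀ w ∈ D, ∀ n, L (ladderY w n) = Y w n) ∧ ∀ w ∉ D, ∀ n, L (ladderRel η w n) = b w n := by
  classical
  -- The relator equation is solved for the next `y`, dividing by `n + 1`.
  let Z : W → ℕ → V := fun w n =>
    Nat.rec 0 (fun n z => ((n + 1 : ℚ)⁻¹) • (b w n + z - X (η w n))) n
  refine ⟨ladderLift X fun w n => if w ∈ D then Y w n else Z w n, by simp,
    fun w hw n => by simp [hw], fun w hw n => ?_⟩
  have hZ : (n + 1) • Z w (n + 1) = b w n + Z w n - X (η w n) := by
    change (n + 1) • ((n + 1 : ℚ)⁻¹) • (b w n + Z w n - X (η w n)) = _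
    rw [← Nat.cast_smul_eq_nsmul ℚ, smul_smul]
    push_cast
    rw [mul_inv_cancel₀ (by positivity), one_smul]
  rw [map_ladderRel]
  simp only [ladderLift_X, ladderLift_Y, if_neg hw]
  rw [hZ]
  abel

/-- A map into a rational vector space can send the relators to a basis. -/
lemma linearIndependent_ladderRel (η : W → ℕ → W) :
    LinearIndependent ℤ fun p : W × ℕ => ladderRel η p.1 p.2 := by
  obtain ⟨L, -, -, hL⟩ := exists_lift_of_rat (V := (W × ℕ) →₀ ℚ) η ∅ (fun _ => 0) (fun _ _ => 0)
    fun w n => Finsupp.single (w, n) 1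
  refine LinearIndependent.of_comp L ?_
  have h : LinearIndependent ℚ fun p : W × ℕ => Finsupp.single p (1 : ℚ) :=
    Finsupp.linearIndependent_single_one ℚ _
  have h2 := h.restrict_scalars' ℤ
  have h3 : L ∘ (fun p : W × ℕ => ladderRel η p.1 p.2) = fun p => Finsupp.single p 1 :=
    funext fun p => hL p.1 (by simp) p.2
  rw [h3]
  exact h2

/-- Used to keep the `y`'s of a ladder on its tail and let the relators determine the finitely many
earlier ones. -/
lemma exists_backward_recursion {V : Type*} [AddCommGroup V] (h : ℕ) (c : ℕ → ℕ) (X y : ℕ → V) :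
    ∃ Y : ℕ → V, (∀ n ≥ h, Y n = y n) ∧ ∀ n < h, Y n = X n + c n • Y (n + 1) := by
  induction h generalizing c X y with
  | zero => exact ⟨y, fun _ _ => rfl, by simp⟩
  | succ h ih =>
    obtain ⟨Y, h1, h2⟩ := ih (fun n => c (n + 1)) (fun n => X (n + 1)) fun n => y (n + 1)
    refine ⟨fun n => Nat.casesOn n (X 0 + c 0 • Y 0) Y, fun n hn => ?_, fun n hn => ?_⟩
    · cases n with
      | zero => omega
      | succ n => exact h1 n (by omega)
    · cases n with
      | zero => rfl
      | succ n => exact h2 n (by omega)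

/-- If the tails of the ladders in `A` are disjoint from each other and from `E`, then there is a
retraction modulo the generators from `E` and the relators from `A`. -/
lemma exists_retraction (η : W → ℕ → W) (E A : Set W) (h : W → ℕ) (hAE : ∀ δ ∈ A, δ ∉ E)
    (hinj : ∀ δ ∈ A, ∀ δ' ∈ A, ∀ n ≥ h δ, ∀ m ≥ h δ', η δ n = η δ' m → δ = δ' ∧ n = m)
    (htail : ∀ δ ∈ A, ∀ n ≥ h δ, η δ n ∉ E) :
    ∃ ρ : ((W ⊕ W × ℕ) →₀ ℤ) →ₗ[ℤ] ((W ⊕ W × ℕ) →₀ ℤ), (∀ v ∈ genSpan E, ρ v = 0) ∧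
      (∀ δ ∈ A, ∀ n, ρ (ladderRel η δ n) = 0) ∧ ∀ v, ρ v - v ∈ genSpan E ⊔ relSpan η A := by
  classical
  let P : W → W × ℕ → Prop := fun w p => p.1 ∈ A ∧ h p.1 ≤ p.2 ∧ η p.1 p.2 = w
  -- If `w` is a tail rung, its relator is solved for `x w`; by `hinj` the rung `(δ, n)` is unique,
  -- so the choice is harmless.
  let X : W → (W ⊕ W × ℕ) →₀ ℤ := fun w =>
    if w ∈ E then 0 else if hw : ∃ p, P w p then
      ladderY hw.choose.1 hw.choose.2 - (hw.choose.2 + 1) • ladderY hw.choose.1 (hw.choose.2 + 1)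
    else ladderX w
  have hXE : ∀ w ∈ E, X w = 0 := fun w hw => if_pos hw
  have hXA : ∀ δ ∈ A, ∀ n ≥ h δ, X (η δ n) = ladderY δ n - (n + 1) • ladderY δ (n + 1) := by
    intro δ hδ n hn
    have hex : ∃ p, P (η δ n) p := ⟨(δ, n), hδ, hn, rfl⟩
    obtain ⟨h1, h2, h3⟩ := hex.choose_spec
    obtain ⟨h4, h5⟩ := hinj _ h1 δ hδ _ h2 n hn h3
    simp only [X, if_neg (htail δ hδ n hn), dif_pos hex]
    rw [h4, h5]
  choose Y hYtail hYrec using fun w => exists_backward_recursion (h w) (fun n => n + 1)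
    (fun n => X (η w n)) (ladderY w)
  have hY : ∀ δ ∈ A, ∀ n, Y δ n = X (η δ n) + (n + 1) • Y δ (n + 1) := by
    intro δ hδ n
    rcases lt_or_ge n (h δ) with hn | hn
    · exact hYrec δ n hn
    · rw [hXA δ hδ n hn, hYtail δ n hn, hYtail δ (n + 1) (by omega)]
      abel
  let Y' : W → ℕ → (W ⊕ W × ℕ) →₀ ℤ := fun w n =>
    if w ∈ E then 0 else if w ∈ A then Y w n else ladderY w n
  have hY'A : ∀ δ ∈ A, ∀ n, Y' δ n = Y δ n := fun δ hδ n => by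
    simp only [Y', if_neg (hAE δ hδ), if_pos hδ]
  set U := genSpan E ⊔ relSpan η A with hU
  have hEU : ∀ v ∈ genSpan E, v ∈ U := fun v hv => Submodule.mem_sup_left hv
  have hX : ∀ w, X w - ladderX w ∈ U := by
    intro w
    by_cases hw : w ∈ E
    · rw [hXE w hw, zero_sub]
      exact neg_mem (hEU _ (ladderX_mem_genSpan hw))
    · by_cases hex : ∃ p, P w p
      · obtain ⟨p, h1, h2, rfl⟩ := hex
        rw [hXA p.1 h1 p.2 h2]
        have : ladderRel η p.1 p.2 ∈ U := Submodule.mem_sup_right (ladderRel_mem_relSpan η h1 _)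
        convert neg_mem this using 1
        rw [ladderRel]
        abel
      · simp only [X, if_neg hw, dif_neg hex, sub_self, zero_mem]
  -- Induction on the distance `k` to the tail, since `Y` is defined downwards from `h δ`.
  have hYU : ∀ δ ∈ A, ∀ k n, h δ ≤ n + k → Y δ n - ladderY δ n ∈ U := by
    intro δ hδ k
    induction k with
    | zero =>
      intro n hn
      rw [hYtail δ n hn, sub_self]
      exact zero_mem _
    | succ k ih =>
      intro n hn
      have h1 := nsmul_mem (ih (n + 1) (by omega)) (n + 1)
      have h2 : ladderRel η δ n ∈ U := Submodule.mem_sup_right (ladderRel_mem_relSpan η hδ _)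
      rw [hY δ hδ n]
      convert add_mem (add_mem (hX (η δ n)) h1) h2 using 1
      rw [ladderRel, smul_sub]
      abel
  refine ⟨ladderLift X Y', fun v hv => ?_, fun δ hδ n => ?_, fun v => ?_⟩
  · refine genSpan_induction (p := fun v => ladderLift X Y' v = 0) (by simp) ?_ ?_ ?_ ?_ hv
    · intro v w hv hw
      rw [map_add, hv, hw, add_zero]
    · intro a v hv
      rw [map_smul, hv, smul_zero]
    · intro w hw
      rw [ladderLift_X, hXE w hw]
    · intro w hw n
      rw [ladderLift_Y]
      exact if_pos hw
  · rw [map_ladderRel, ladderLift_X, ladderLift_Y, ladderLift_Y, hY'A δ hδ, hY'A δ hδ, hY δ hδ n]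
    abel
  · refine genSpan_induction (D := Set.univ) (p := fun v => ladderLift X Y' v - v ∈ U) (by simp)
      ?_ ?_ ?_ ?_ (by simp [genSpan_univ])
    · intro v w hv hw
      convert add_mem hv hw using 1
      rw [map_add]
      abel
    · intro a v hv
      rw [map_smul, ← smul_sub]
      exact Submodule.smul_mem _ _ hv
    · intro w _
      rw [ladderLift_X]
      exact hX w
    · intro w _ n
      rw [ladderLift_Y]
      by_cases hw : w ∈ E
      · simp only [Y', if_pos hw, zero_sub]
        exact neg_mem (hEU _ (ladderY_mem_genSpan hw n))
      · by_cases hA : w ∈ A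
        · rw [hY'A w hA]
          exact hYU w hA (h w) n (by omega)
        · simp only [Y', if_neg hw, if_neg hA, sub_self, zero_mem]

end LadderGroup

/-! ### Cardinalities, γ-free groups and maps on relators -/

lemma mk_finsupp_int_le (ι : Type u) : #(ι →₀ ℤ) ≤ max #ι ℵ₀ := by
  cases isEmpty_or_nonempty ι
  · simp
  · simp [mk_finsupp_lift_of_infinite']

lemma mk_genSpan_lt {W : Type u} {γ : Cardinal.{u}} (hγ0 : ℵ₀ < γ) (D : Set W) (hD : #D < γ) :
    #(genSpan D) < γ := by
  change #(Finsupp.supported ℤ ℤ (ladderIndex ⁻¹' D)) < γ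
  rw [(Finsupp.supportedEquivFinsupp (M := ℤ) (R := ℤ) (ladderIndex ⁻¹' D : Set (W ⊕ W × ℕ))).toEquiv.cardinal_eq]
  have h : #(ladderIndex ⁻¹' D : Set (W ⊕ W × ℕ)) < γ := by
    let e : (ladderIndex ⁻¹' D : Set (W ⊕ W × ℕ)) → D × Option ℕ := fun i =>
      (⟨ladderIndex i.1, i.2⟩, Sum.elim (fun _ => none) (fun p => some p.2) i.1)
    have he : Function.Injective e := by
      rintro ⟨i | ⟨i, n⟩, hi⟩ ⟨k | ⟨k, m⟩, hk⟩ h <;> simp_all [e, ladderIndex]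
    refine (mk_le_of_injective he).trans_lt ?_
    rw [mk_prod, Cardinal.lift_uzero, mk_eq_aleph0 (Option ℕ), lift_aleph0]
    exact mul_lt_of_lt hγ0.le hD hγ0
  exact (mk_finsupp_int_le _).trans_lt (max_lt h hγ0)

lemma mk_quotient_le {W : Type u} {γ : Cardinal.{u}} (hγ0 : ℵ₀ ≤ γ) (hW : #W ≤ γ)
    (N : AddSubgroup ((W ⊕ W × ℕ) →₀ ℤ)) : #(((W ⊕ W × ℕ) →₀ ℤ) ⧸ N) ≤ γ := by
  refine (mk_le_of_surjective (QuotientAddGroup.mk'_surjective N)).trans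
    ((mk_finsupp_int_le _).trans (max_le ?_ hγ0))
  rw [mk_sum, mk_prod]
  simp only [Cardinal.lift_id, Cardinal.lift_uzero, mk_nat, lift_aleph0]
  exact add_le_of_le hγ0 hW (mul_le_of_le hγ0 hW hγ0)

lemma IsKappaFree.isAddTorsionFree {γ : Cardinal.{u}} (hγ0 : ℵ₀ < γ) {G : Type u} [AddCommGroup G]
    (hG : IsKappaFree γ G) : IsAddTorsionFree G := by
  have h0 : ∀ (n : ℕ) (c : G), n ≠ 0 → n • c = 0 → c = 0 := fun n c hn hc => by
    have := hG (AddSubgroup.zmultiples c) ((mk_le_aleph0 (α := AddSubgroup.zmultiples c)).trans_lt hγ0)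
    have hc' : (n : ℤ) • (⟨c, AddSubgroup.mem_zmultiples c⟩ : AddSubgroup.zmultiples c) = 0 :=
      Subtype.ext (by simpa using hc)
    have := (smul_eq_zero.1 hc').resolve_left (by exact_mod_cast hn)
    exact congrArg Subtype.val this
  refine ⟨fun n hn a b hab => sub_eq_zero.1 (h0 n _ hn ?_)⟩
  rw [smul_sub]
  exact sub_eq_zero.2 hab

lemma subsingleton_ext_of_free (G T : Type u) [AddCommGroup G] [AddCommGroup T]
    [Module.Free ℤ G] : Subsingleton (ZExt G T) :=
  subsingleton_ext_of_exists_extension (A := PUnit.{u+1}) (F := G) 0 (AddMonoidHom.id G)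
    (fun _ _ _ => rfl) Function.surjective_id (fun x => by simp [eq_comm])
    fun ψ => ⟨0, by ext x; exact (map_zero ψ).symm⟩

/-- A γ-free group smaller than `γ` is itself free, so its Ext vanishes. -/
lemma le_mk_of_isKappaFree_of_nontrivial_ext {γ : Cardinal.{u}} {G T : Type u} [AddCommGroup G]
    [AddCommGroup T] (hG : IsKappaFree γ G) (hext : Nontrivial (ZExt G T)) : γ ≤ #G := by
  by_contra! hlt
  have h1 : Module.Free ℤ (⊤ : AddSubgroup G) :=
    hG ⊤ ((mk_le_of_injective Subtype.val_injective).trans_lt hlt)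
  have : Module.Free ℤ G := Module.Free.of_injective_addMonoidHom
    (AddSubgroup.topEquiv (G := G)).symm.toAddMonoidHom AddSubgroup.topEquiv.symm.injective
  exact not_subsingleton_iff_nontrivial.2 hext (subsingleton_ext_of_free G T)

lemma exists_hom_relSpan {T : Type*} [AddCommGroup T] {W : Type*} (η : W → ℕ → W) (D : Set W)
    (c : W → ℕ → T) : ∃ ψ : (relSpan η D).toAddSubgroup →+ T,
      ∀ w (hw : w ∈ D) n, ψ ⟨ladderRel η w n, ladderRel_mem_relSpan η hw n⟩ = c w n := by
  let b := Module.Basis.span (linearIndependent_ladderRel η)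
  let ψ := b.constr ℤ fun p => c p.1 p.2
  have hle : relSpan η D ≤ Submodule.span ℤ (Set.range fun p : W × ℕ => ladderRel η p.1 p.2) :=
    relSpan_le fun w _ n => Submodule.subset_span ⟨(w, n), rfl⟩
  refine ⟨(ψ ∘ₗ Submodule.inclusion hle).toAddMonoidHom, fun w hw n => ?_⟩
  change ψ _ = _
  rw [← b.constr_basis ℤ (fun p => c p.1 p.2) (w, n)]
  congr 1
  exact Subtype.ext (congrArg Subtype.val
    (Module.Basis.span_apply (linearIndependent_ladderRel η) (w, n))).symm

/-! ### The group of a ladder system: freeness and Ext -/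

section LadderSystem
variable {W : Type u} [LinearOrder W]

/-- A system of ladders on `S` all of whose bounded parts have pairwise disjoint tails. -/
structure IsLadderSystem (S : Set W) (η : W → ℕ → W) : Prop where
  strictMono : ∀ δ ∈ S, StrictMono (η δ)
  lt : ∀ δ ∈ S, ∀ n, η δ n < δ
  cofinal : ∀ δ ∈ S, ∀ β < δ, ∃ n, β ≤ η δ n
  disjoint_tails : ∀ j, ∃ h : W → ℕ, ∀ δ ∈ S, ∀ δ' ∈ S, δ < j → δ' < j → δ ≠ δ' →
    ∀ n ≥ h δ, ∀ m ≥ h δ', η δ n ≠ η δ' m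

variable {S : Set W} {η : W → ℕ → W}

/-- Since `E` is a lower set, a ladder that leaves `E` once stays outside, so its tail avoids `E`;
relators of `δ ∈ E` already lie in the span of the generators from `E`. -/
lemma IsLadderSystem.exists_retraction (hη : IsLadderSystem S η) {E : Set W} (hE : IsLowerSet E)
    (hES : ∀ δ ∈ S, δ ∉ E → ∃ n, η δ n ∉ E) (j : W) :
    ∃ ρ : ((W ⊕ W × ℕ) →₀ ℤ) →ₗ[ℤ] ((W ⊕ W × ℕ) →₀ ℤ), (∀ v ∈ genSpan E, ρ v = 0) ∧
      (∀ δ ∈ S, δ ∈ E ∪ Set.Iio j → ∀ n, ρ (ladderRel η δ n) = 0) ∧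
      ∀ v, ρ v - v ∈ genSpan E ⊔ relSpan η (S ∩ Set.Iio j) := by
  obtain ⟨h, hh⟩ := hη.disjoint_tails j
  have hk : ∀ δ, ∃ k, δ ∈ S → δ ∉ E → η δ k ∉ E := fun δ => by
    by_cases hδ : δ ∈ S ∧ δ ∉ E
    · obtain ⟨n, hn⟩ := hES δ hδ.1 hδ.2
      exact ⟨n, fun _ _ => hn⟩
    · exact ⟨0, fun h1 h2 => absurd ⟨h1, h2⟩ hδ⟩
  choose k hk using hk
  obtain ⟨ρ, h1, h2, h3⟩ := _root_.exists_retraction η E {δ | δ ∈ S ∧ δ < j ∧ δ ∉ E}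
    (fun δ => max (h δ) (k δ)) (fun δ hδ => hδ.2.2)
    (fun δ hδ δ' hδ' n hn m hm heq => by
      by_cases hne : δ = δ'
      · subst hne
        exact ⟨rfl, (hη.strictMono δ hδ.1).injective heq⟩
      · exact absurd heq (hh δ hδ.1 δ' hδ'.1 hδ.2.1 hδ'.2.1 hne n (le_of_max_le_left hn) m
          (le_of_max_le_left hm)))
    (fun δ hδ n hn hmem => hk δ hδ.1 hδ.2.2 (hE ((hη.strictMono δ hδ.1).monotone
      (le_of_max_le_right hn)) hmem))
  refine ⟨ρ, h1, fun δ hδ hδj n => ?_, fun v => ?_⟩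
  · by_cases hδE : δ ∈ E
    · exact h1 _ (ladderRel_mem_genSpan hδE n (hE (hη.lt δ hδ n).le hδE))
    · exact h2 δ ⟨hδ, hδj.resolve_left hδE, hδE⟩ n
  · have hsub : {δ | δ ∈ S ∧ δ < j ∧ δ ∉ E} ⊆ S ∩ Set.Iio j := fun δ hδ => ⟨hδ.1, hδ.2.1⟩
    exact sup_le_sup_left (relSpan_mono η hsub) _ (h3 v)

lemma IsLadderSystem.free_quotient (hη : IsLadderSystem S η) (j : W) {D : Set W}
    (hD : D = S ∩ Set.Iio j) :
    Module.Free ℤ (((W ⊕ W × ℕ) →₀ ℤ) ⧸ (relSpan η D).toAddSubgroup) := by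
  subst hD
  obtain ⟨ρ, -, h2, h3⟩ := hη.exists_retraction (E := ∅) isLowerSet_empty (by simp) j
  rw [genSpan_empty, bot_sup_eq] at h3
  have hker : relSpan η (S ∩ Set.Iio j) ≤ LinearMap.ker ρ :=
    relSpan_le fun w hw n => h2 w hw.1 (Or.inr hw.2) n
  refine Module.Free.of_injective_addMonoidHom
    (QuotientAddGroup.lift (relSpan η (S ∩ Set.Iio j)).toAddSubgroup ρ.toAddMonoidHom
      fun v hv => hker hv) ?_
  rw [injective_iff_map_eq_zero]
  intro q hq
  obtain ⟨v, rfl⟩ := QuotientAddGroup.mk_surjective q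
  have hv : ρ v = 0 := hq
  refine (QuotientAddGroup.eq_zero_iff v).2 ?_
  have := h3 v
  rw [hv, zero_sub] at this
  exact neg_mem_iff.1 this

/-- The embedding of integral into rational finitely supported functions. -/
noncomputable def finsuppIntToRat (ι : Type*) : (ι →₀ ℤ) →ₗ[ℤ] (ι →₀ ℚ) :=
  (Finsupp.mapRange.addMonoidHom (Int.castAddHom ℚ)).toIntLinearMap

lemma finsuppIntToRat_injective (ι : Type*) : Function.Injective (finsuppIntToRat ι) :=
  Finsupp.mapRange_injective _ (by simp) Int.cast_injective

/-- `ρ` is only known to kill the relators of `D`. Over ℚ, where division by `n + 1` is possible,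
its restriction to the generators of `D` extends to a map killing all relators. Hence `ρ` vanishes
on elements of `genSpan D` that lie in `relSpan η S`. -/
lemma IsLadderSystem.exists_rational_extension (hη : IsLadderSystem S η) {D : Set W}
    (hD : IsLowerSet D) (ρ : ((W ⊕ W × ℕ) →₀ ℤ) →ₗ[ℤ] ((W ⊕ W × ℕ) →₀ ℤ))
    (hρ : ∀ δ ∈ S, δ ∈ D → ∀ n, ρ (ladderRel η δ n) = 0) :
    ∃ ρ' : ((W ⊕ W × ℕ) →₀ ℤ) →ₗ[ℤ] ((W ⊕ W × ℕ) →₀ ℚ),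
      (∀ v ∈ genSpan D, ρ' v = finsuppIntToRat _ (ρ v)) ∧ ∀ v ∈ relSpan η S, ρ' v = 0 := by
  obtain ⟨ρ', hX, hY, hrel⟩ := exists_lift_of_rat η D (fun w => finsuppIntToRat _ (ρ (ladderX w)))
    (fun w n => finsuppIntToRat _ (ρ (ladderY w n))) (fun _ _ => 0)
  have hagree : ∀ v ∈ genSpan D, ρ' v = finsuppIntToRat _ (ρ v) := fun v hv => by
    refine genSpan_induction (p := fun v => ρ' v = finsuppIntToRat _ (ρ v)) (by simp) ?_ ?_
      (fun w _ => hX w) hY hv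
    · intro v w hv hw
      rw [map_add, map_add, map_add, hv, hw]
    · intro a v hv
      rw [map_smul, map_smul, map_smul, hv]
  refine ⟨ρ', hagree, fun v hv => ?_⟩
  refine (relSpan_le (U := LinearMap.ker ρ') fun w hw n => ?_) hv
  by_cases hwD : w ∈ D
  · rw [LinearMap.mem_ker, hagree _ (ladderRel_mem_genSpan hwD n (hD (hη.lt w hw n).le hwD)),
      hρ w hw hwD n, map_zero]
  · exact hrel w hwD n

/-- In a regular well-order, small sets only involve generators from a proper initial segment. -/
lemma exists_subset_genSpan_Iio {γ : Cardinal.{u}} (hγ : γ.IsRegular) (hγ0 : ℵ₀ < γ)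
    (hW : γ ≤ Order.cof W) (s : Set ((W ⊕ W × ℕ) →₀ ℤ)) (hs : #s < γ) :
    ∃ j : W, ∀ v ∈ s, v ∈ genSpan (Set.Iio j) := by
  have hcard : #(⋃ v ∈ s, ladderIndex '' (v.support : Set (W ⊕ W × ℕ)) : Set W) < γ := by
    rw [card_biUnion_lt_iff_forall_of_isRegular hγ hs]
    intro v _
    refine lt_of_lt_of_le ?_ hγ0.le
    exact lt_aleph0_iff_set_finite.2 (v.support.finite_toSet.image _)
  have hnc : ¬ IsCofinal (⋃ v ∈ s, ladderIndex '' (v.support : Set (W ⊕ W × ℕ)) : Set W) :=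
    fun h => (hW.trans (Order.cof_le h)).not_gt hcard
  obtain ⟨j, hj⟩ := not_isCofinal_iff.1 hnc
  refine ⟨j, fun v hv => ?_⟩
  refine (Finsupp.mem_supported _ _).2 fun i hi => hj _ ?_
  exact Set.mem_biUnion hv ⟨i, hi, rfl⟩

/-- Lift a small subgroup to bounded representatives `σ q`. Then `q ↦ ρ (σ q)` is additive because
the rational extension of `ρ` kills the kernel of `π`, and injective because `ρ v - v` lies in that
kernel; so the subgroup embeds in a free group. -/
lemma IsLadderSystem.isKappaFree {γ : Cardinal.{u}} (hγ : γ.IsRegular) (hγ0 : ℵ₀ < γ)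
    (hW : γ ≤ Order.cof W) (hη : IsLadderSystem S η) {E : Set W} (hE : IsLowerSet E)
    (hES : ∀ δ ∈ S, δ ∉ E → ∃ n, η δ n ∉ E) {Q : Type u} [AddCommGroup Q]
    (π : ((W ⊕ W × ℕ) →₀ ℤ) →+ Q) (hπ : Function.Surjective π)
    (hker : ∀ v, π v = 0 ↔ v ∈ genSpan E ⊔ relSpan η S) : IsKappaFree γ Q := by
  intro H hH
  choose σ hσ using fun q : H => hπ q
  obtain ⟨j, hj⟩ := exists_subset_genSpan_Iio hγ hγ0 hW (Set.range σ) (mk_range_le.trans_lt hH)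
  obtain ⟨ρ, h1, h2, h3⟩ := hη.exists_retraction hE hES j
  obtain ⟨ρ', h4, h5⟩ := hη.exists_rational_extension (hE.union (isLowerSet_Iio j)) ρ h2
  have hσD : ∀ q, σ q ∈ genSpan (E ∪ Set.Iio j) := fun q =>
    genSpan_mono Set.subset_union_right (hj _ ⟨q, rfl⟩)
  have hρ'ker : ∀ v, π v = 0 → ρ' v = 0 := fun v hv => by
    refine (sup_le (fun v hv => ?_) h5 : genSpan E ⊔ relSpan η S ≤ LinearMap.ker ρ') ((hker v).1 hv)
    rw [LinearMap.mem_ker, h4 v (genSpan_mono Set.subset_union_left hv), h1 v hv, map_zero]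
  refine Module.Free.of_injective_addMonoidHom
    (AddMonoidHom.mk' (fun q : H => ρ (σ q)) fun a b => ?_) ?_
  · apply finsuppIntToRat_injective
    rw [map_add, ← h4 _ (hσD a), ← h4 _ (hσD b), ← h4 _ (hσD _), ← sub_eq_zero, ← map_add,
      ← map_sub]
    apply hρ'ker
    rw [map_sub, map_add, hσ, hσ, hσ]
    simp
  · rw [injective_iff_map_eq_zero]
    intro q hq
    have hq0 : ρ (σ q) = 0 := hq
    have := h3 (σ q)
    rw [hq0, zero_sub, neg_mem_iff] at this
    have hmem := sup_le_sup_left (relSpan_mono η Set.inter_subset_left) _ this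
    exact Subtype.ext ((hσ q).symm.trans ((hker _).2 hmem))

lemma IsLadderSystem.isStronglyKappaFree {γ : Cardinal.{u}} (hγ : γ.IsRegular) (hγ0 : ℵ₀ < γ)
    (hW : γ ≤ Order.cof W) (hW' : ∀ w : W, #(Set.Iio w) < γ) (hη : IsLadderSystem S η)
    (hS : ∀ j, ∃ β ≥ j, β ∉ S) :
    IsStronglyKappaFree γ (((W ⊕ W × ℕ) →₀ ℤ) ⧸ (relSpan η S).toAddSubgroup) := by
  set N := (relSpan η S).toAddSubgroup with hN
  have hker : ∀ v, QuotientAddGroup.mk' N v = 0 ↔ v ∈ relSpan η S := fun v =>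
    QuotientAddGroup.eq_zero_iff v
  refine ⟨hη.isKappaFree hγ hγ0 hW isLowerSet_empty (by simp) (QuotientAddGroup.mk' N)
    (QuotientAddGroup.mk'_surjective N) fun v => by rw [genSpan_empty, bot_sup_eq, hker], ?_⟩
  intro H hH
  choose σ hσ using fun q : H => QuotientAddGroup.mk'_surjective N q
  obtain ⟨j, hj⟩ := exists_subset_genSpan_Iio hγ hγ0 hW (Set.range σ) (mk_range_le.trans_lt hH)
  -- `β ∉ S` is needed because the ladder of `β` itself would never leave the segment below `β`.
  obtain ⟨β, hβ, hβS⟩ := hS j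
  let K := (genSpan (Set.Iio β)).toAddSubgroup.map (QuotientAddGroup.mk' N)
  have hK : #K < γ := by
    refine lt_of_le_of_lt ?_ (mk_genSpan_lt hγ0 _ (hW' β))
    exact mk_le_of_surjective
      (f := fun v : genSpan (Set.Iio β) => (⟨QuotientAddGroup.mk' N v.1, ⟨v.1, v.2, rfl⟩⟩ : K))
      (by rintro ⟨_, v, hv, rfl⟩; exact ⟨⟨v, hv⟩, rfl⟩)
  refine ⟨K, fun q hq => ?_, hK, ?_⟩
  · exact ⟨σ ⟨q, hq⟩, genSpan_mono (Set.Iio_subset_Iio hβ) (hj _ ⟨_, rfl⟩), hσ ⟨q, hq⟩⟩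
  · refine hη.isKappaFree hγ hγ0 hW (isLowerSet_Iio β) (fun δ hδ hδβ => ?_)
      ((QuotientAddGroup.mk' K).comp (QuotientAddGroup.mk' N))
      ((QuotientAddGroup.mk'_surjective K).comp (QuotientAddGroup.mk'_surjective N)) fun v => ?_
    · have hlt : β < δ := lt_of_le_of_ne (not_lt.1 hδβ) fun h => hβS (h ▸ hδ)
      obtain ⟨n, hn⟩ := hη.cofinal δ hδ β hlt
      exact ⟨n, hn.not_gt⟩
    · rw [AddMonoidHom.comp_apply, QuotientAddGroup.mk'_apply, QuotientAddGroup.eq_zero_iff,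
        Submodule.mem_sup]
      constructor
      · rintro ⟨w, hw, hwv⟩
        refine ⟨w, hw, v - w, ?_, by abel⟩
        rw [← hker, map_sub, hwv, sub_self]
      · rintro ⟨w, hw, r, hr, rfl⟩
        refine ⟨w, hw, ?_⟩
        rw [map_add, (hker r).2 hr, add_zero]

/-- If the values `g δ` guess all functions `W → B`, then the group presented by the relators has
a nontrivial extension by any group mapping onto `B`. -/
lemma nontrivial_ext_of_guesses (hlt : ∀ δ ∈ S, ∀ n, η δ n < δ) {T B : Type u} [AddCommGroup T]
    [AddCommGroup B] (f : T →+ B) (hf : Function.Surjective f) (hB : ¬ FactorialSystemsSolvable B)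
    (g : W → W → B) (hg : ∀ k : W → B, ∃ δ ∈ S, ∀ α < δ, g δ α = k α) :
    Nontrivial (ZExt (((W ⊕ W × ℕ) →₀ ℤ) ⧸ (relSpan η S).toAddSubgroup) T) := by
  simp only [FactorialSystemsSolvable] at hB
  push Not at hB
  obtain ⟨b, hb⟩ := hB
  -- Lifts to `T` of the values the relators would take in `B` if the `x`'s had the guessed values
  -- and the `y`'s solved the unsolvable system `b`.
  choose t ht using fun (w : W) (n : ℕ) => hf (g w (η w n) - b n)
  obtain ⟨ψ, hψ⟩ := exists_hom_relSpan η S t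
  rw [← not_subsingleton_iff_nontrivial]
  intro hsub
  let N := (relSpan η S).toAddSubgroup
  obtain ⟨φ, hφ⟩ := exists_extension_of_subsingleton_ext N.subtype (QuotientAddGroup.mk' N)
    N.subtype_injective (QuotientAddGroup.mk'_surjective N) (fun x => by simp) hsub ψ
  obtain ⟨δ, hδS, hδ⟩ := hg fun α => f (φ (ladderX α))
  obtain ⟨n, hn⟩ := hb fun n => f (φ (ladderY δ n))
  apply hn
  have h1 : φ (ladderRel η δ n) = t δ n := by
    rw [← hψ δ hδS n]
    exact DFunLike.congr_fun hφ ⟨_, ladderRel_mem_relSpan η hδS n⟩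
  have h2 := ht δ n
  rw [← h1, hδ _ (hlt δ hδS n), ladderRel, map_add, map_sub, map_nsmul, map_add, map_sub,
    map_nsmul] at h2
  rw [← sub_eq_zero] at h2 ⊢
  rw [← neg_eq_zero, ← h2]
  abel

end LadderSystem

/-! ### Assembling the suitable group -/

section Main
open Ordinal

lemma exists_image_not_solvable {γ : Cardinal.{u}} (hγ0 : ℵ₀ ≤ γ) (T : Type u) [AddCommGroup T]
    (hT : ¬ IsCotorsion T)
    (himage : (∃ (B : Type u) (_ : AddCommGroup B) (f : T →+ B),
        Function.Surjective f ∧ #B ≤ γ ∧ ¬ IsCotorsion B) ∨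
      IsAddTorsion T ∨ #T ≤ γ) :
    ∃ (B : Type u) (_ : AddCommGroup B) (f : T →+ B),
      Function.Surjective f ∧ #B ≤ γ ∧ ¬ FactorialSystemsSolvable B := by
  rcases himage with ⟨B, hB, f, hf, hBγ, hcot⟩ | htors | hTγ
  · exact ⟨B, hB, f, hf, hBγ, fun h => hcot h.isCotorsion⟩
  · have hchain : FactorialChainNonstationary T := by
      by_contra h
      exact hT (factorialSystemsSolvable_of_stationary h).isCotorsion
    obtain ⟨K, hK, hKchain⟩ := exists_countable_quotient_of_torsion htors hchain
    exact ⟨T ⧸ K, inferInstance, QuotientAddGroup.mk' K, QuotientAddGroup.mk'_surjective K,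
      mk_le_aleph0.trans hγ0, hKchain.not_solvable⟩
  · exact ⟨T, inferInstance, AddMonoidHom.id T, Function.surjective_id, hTγ,
      fun h => hT h.isCotorsion⟩

/-- A non-reflecting set of ordinals of countable cofinality below `γ` carries a ladder system. -/
lemma exists_isLadderSystem {γ : Cardinal.{u}} (S : Set Ordinal.{u})
    (hnonrefl : NonReflectingIn S γ.ord) (hcof : ∀ α ∈ S, α.cof = ℵ₀) :
    ∃ η : γ.ord.ToType → ℕ → γ.ord.ToType,
      IsLadderSystem {w : γ.ord.ToType | (ToType.toOrd w).1 ∈ S} η := by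
  have hex : ∀ δ : Ordinal.{u}, ∃ f : ℕ → Ordinal.{u}, δ ∈ S →
      StrictMono f ∧ (∀ n, f n < δ) ∧ ∀ β < δ, ∃ n, β ≤ f n := fun δ => by
    by_cases hδ : δ ∈ S
    · obtain ⟨f, hf⟩ := exists_strictMono_cofinal_of_cof_eq_aleph0 (hcof δ hδ)
      exact ⟨f, fun _ => hf⟩
    · exact ⟨0, fun h => absurd h hδ⟩
  choose f hf using hex
  classical
  let η : γ.ord.ToType → ℕ → γ.ord.ToType := fun w n =>
    if h : f (ToType.toOrd w).1 n < γ.ord then ToType.mk ⟨_, h⟩ else w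
  have hη : ∀ w : γ.ord.ToType, (ToType.toOrd w).1 ∈ S → ∀ n,
      (ToType.toOrd (η w n)).1 = f (ToType.toOrd w).1 n := fun w hw n => by
    have h : f (ToType.toOrd w).1 n < γ.ord := ((hf _ hw).2.1 n).trans (ToType.toOrd w).2
    simp only [η, dif_pos h, ToType.toOrd, OrderIso.symm_apply_apply]
  have hlt : ∀ v w : γ.ord.ToType, v < w ↔ (ToType.toOrd v).1 < (ToType.toOrd w).1 := fun v w =>
    (ToType.mk.symm.lt_iff_lt (x := v) (y := w)).symm
  have hle : ∀ v w : γ.ord.ToType, v ≤ w ↔ (ToType.toOrd v).1 ≤ (ToType.toOrd w).1 := fun v w =>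
    (ToType.mk.symm.le_iff_le (x := v) (y := w)).symm
  refine ⟨η, ⟨fun δ hδ m n hmn => ?_, fun δ hδ n => ?_, fun δ hδ β hβ => ?_, fun j => ?_⟩⟩
  · rw [hlt, hη δ hδ, hη δ hδ]
    exact (hf _ hδ).1 hmn
  · rw [hlt, hη δ hδ]
    exact (hf _ hδ).2.1 n
  · obtain ⟨n, hn⟩ := (hf _ hδ).2.2 _ ((hlt _ _).1 hβ)
    exact ⟨n, (hle _ _).2 (by rwa [hη δ hδ])⟩
  · obtain ⟨h, hh⟩ := exists_disjoint_tails hnonrefl f (fun δ hδ => (hf δ hδ).1)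
      (fun δ hδ => (hf δ hδ).2.1) (fun δ hδ => (hf δ hδ).2.2) (ToType.toOrd j).1
      (ToType.toOrd j).2
    refine ⟨fun w => h (ToType.toOrd w).1, fun δ hδ δ' hδ' hj hj' hne n hn m hm heq => ?_⟩
    refine hh _ hδ _ hδ' ((hlt _ _).1 hj).le ((hlt _ _).1 hj').le
      (fun h => hne (ToType.mk.symm.injective (Subtype.ext h))) n hn m hm ?_
    rw [← hη δ hδ, ← hη δ' hδ', heq]

lemma rank_relSpan_le {γ : Cardinal.{u}} (η : γ.ord.ToType → ℕ → γ.ord.ToType)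
    (D : Set γ.ord.ToType) (i : Ordinal.{u}) (hD : ∀ w ∈ D, (ToType.toOrd w).1 < i) :
    Module.rank ℤ (relSpan η D) ≤ i.card + ℵ₀ := by
  refine (rank_span_le _).trans (mk_image_le.trans ?_)
  let e : {p : γ.ord.ToType × ℕ | p.1 ∈ D} → i.ToType × ℕ := fun p =>
    (ToType.mk ⟨(ToType.toOrd p.1.1).1, hD _ p.2⟩, p.1.2)
  have he : Function.Injective e := by
    rintro ⟨⟨a, m⟩, ha⟩ ⟨⟨b, n⟩, hb⟩ h
    obtain ⟨h1, h2⟩ := Prod.ext_iff.1 h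
    have h3 : (⟨(ToType.toOrd a).1, hD _ ha⟩ : Set.Iio i) = ⟨(ToType.toOrd b).1, hD _ hb⟩ :=
      ToType.mk.injective h1
    have h4 : a = b := ToType.mk.symm.injective (Subtype.ext (Subtype.mk.inj h3))
    have h5 : m = n := h2
    subst h4 h5
    rfl
  refine (mk_le_of_injective he).trans ?_
  rw [mk_prod, Cardinal.lift_uzero, mk_toType, mk_nat, lift_aleph0]
  exact (mul_le_max_of_aleph0_le_right le_rfl).trans
    (max_le (self_le_add_right _ _) (self_le_add_left _ _))


/-- The initial segments of the relators exhaust the relators. -/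
lemma coe_relSpan_eq_iUnion {γ : Ordinal.{u}} (hγ : Order.IsSuccLimit γ)
    (η : γ.ToType → ℕ → γ.ToType) (D : Set γ.ToType) :
    (relSpan η {w | w ∈ D ∧ (ToType.toOrd w).1 < γ} : Set ((γ.ToType ⊕ γ.ToType × ℕ) →₀ ℤ)) =
      ⋃ i < γ, (relSpan η {w | w ∈ D ∧ (ToType.toOrd w).1 < i} : Set _) := by
  have hmono : ∀ i j : Ordinal.{u}, i ≤ j → relSpan η {w | w ∈ D ∧ (ToType.toOrd w).1 < i} ≤
      relSpan η {w | w ∈ D ∧ (ToType.toOrd w).1 < j} := fun i j hij =>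
    relSpan_mono η fun w hw => ⟨hw.1, hw.2.trans_le hij⟩
  refine Set.Subset.antisymm (fun v hv => ?_) (Set.iUnion₂_subset fun i hi => hmono i γ hi.le)
  simp only [Set.mem_iUnion, SetLike.mem_coe] at hv ⊢
  induction hv using Submodule.span_induction with
  | mem v hv =>
    obtain ⟨p, hp, rfl⟩ := hv
    exact ⟨(ToType.toOrd p.1).1 + 1, hγ.add_one_lt (ToType.toOrd p.1).2,
      ladderRel_mem_relSpan η (D := {w | w ∈ D ∧ (ToType.toOrd w).1 < (ToType.toOrd p.1).1 + 1})
        ⟨hp.1, lt_add_one _⟩ _⟩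
  | zero => exact ⟨0, hγ.bot_lt, zero_mem _⟩
  | add v w _ _ hv hw =>
    obtain ⟨i, hi, hv⟩ := hv
    obtain ⟨j, hj, hw⟩ := hw
    exact ⟨max i j, max_lt hi hj,
      add_mem (hmono i _ (le_max_left i j) hv) (hmono j _ (le_max_right i j) hw)⟩
  | smul a v _ hv =>
    obtain ⟨i, hi, hv⟩ := hv
    exact ⟨i, hi, Submodule.smul_mem _ a hv⟩

end Main

open Ordinal in
theorem mainTheorem11 (lam γ : Cardinal.{u}) (hlam : lam.IsRegular) (hγ : γ.IsRegular)
    (hγlam : γ < lam)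
    (S : Set Ordinal.{u}) (hSγ : S ⊆ Set.Iio γ.ord)
    (hstat : StationaryIn S γ.ord) (hnonrefl : NonReflectingIn S γ.ord)
    (hcof : ∀ α ∈ S, α.cof = ℵ₀) (hdiamond : DiamondOn S γ.ord)
    (T : Type u) [AddCommGroup T] (hTlam : #T < lam) (hT : ¬ IsCotorsion T)
    (himage : (∃ (B : Type u) (_ : AddCommGroup B) (f : T →+ B),
        Function.Surjective f ∧ #B ≤ γ ∧ ¬ IsCotorsion B) ∨
      IsAddTorsion T ∨ #T ≤ γ) :
    ∃ (G : Type u) (_ : AddCommGroup G),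
      IsStronglyKappaFree γ G ∧ IsAddTorsionFree G ∧ #G = γ ∧ IsSuitable T lam γ G := by
  classical
  -- Stationarity provides an element of `S`, an ordinal below `γ` of cofinality ω.
  have hγ0 : ℵ₀ < γ := by
    obtain ⟨⟨α, hα⟩, hαS⟩ := IsStationary.nonempty hstat
    rw [← hcof α hαS]
    exact (cof_le_card α).trans_lt (lt_ord.1 hα)
  have hlimit : Order.IsSuccLimit γ.ord := isSuccLimit_ord hγ.aleph0_le
  obtain ⟨B, _, f, hf, hBγ, hBns⟩ := exists_image_not_solvable hγ0.le T hT himage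
  obtain ⟨η, hη⟩ := exists_isLadderSystem S hnonrefl hcof
  obtain ⟨g, hg⟩ := hdiamond.exists_guesses hγ hγ0 B hBγ
  have hWcof : γ ≤ Order.cof γ.ord.ToType := by rw [cof_toType, hγ.cof_ord]
  have hWcard : ∀ w : γ.ord.ToType, #(Set.Iio w) < γ := fun w => by
    simpa using mk_Iio_lt w (by simp)
  have hmk : ∀ (α : Ordinal.{u}) (hα : α < γ.ord), (ToType.toOrd (ToType.mk ⟨α, hα⟩)).1 = α :=
    fun α hα => by simp only [ToType.toOrd, OrderIso.symm_apply_apply]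
  have hlt : ∀ v w : γ.ord.ToType, v < w ↔ (ToType.toOrd v).1 < (ToType.toOrd w).1 := fun v w =>
    (ToType.mk.symm.lt_iff_lt (x := v) (y := w)).symm
  set SW : Set γ.ord.ToType := {w | (ToType.toOrd w).1 ∈ S} with hSW
  -- Successors have cofinality 1, so they are not in `S`.
  have hsucc : ∀ j : γ.ord.ToType, ∃ β ≥ j, β ∉ SW := fun j => by
    refine ⟨ToType.mk ⟨(ToType.toOrd j).1 + 1, hlimit.add_one_lt (ToType.toOrd j).2⟩, ?_,
      fun h => ?_⟩
    · refine le_of_lt ((hlt _ _).2 ?_)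
      rw [hmk]
      exact lt_add_one _
    · have h1 : (ToType.toOrd (ToType.mk ⟨(ToType.toOrd j).1 + 1, _⟩)).1 ∈ S := h
      rw [hmk] at h1
      have := hcof _ h1
      rw [cof_add_one] at this
      exact one_lt_aleph0.ne this
  have hguess : ∀ k : γ.ord.ToType → B, ∃ δ ∈ SW, ∀ α < δ,
      g (ToType.toOrd δ).1 (ToType.toOrd α).1 = k α := fun k => by
    obtain ⟨δ, hδS, hδγ, hδ⟩ := hg fun α =>
      if hα : α < γ.ord then k (ToType.mk ⟨α, hα⟩) else 0
    refine ⟨ToType.mk ⟨δ, hδγ⟩, ?_, fun α hα => ?_⟩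
    · change (ToType.toOrd (ToType.mk ⟨δ, hδγ⟩)).1 ∈ S
      rwa [hmk]
    · rw [hlt, hmk] at hα
      rw [hmk, hδ _ hα, dif_pos (hα.trans hδγ)]
      exact congrArg k (ToType.mk.apply_symm_apply _)
  let Fc : Ordinal.{u} → AddSubgroup ((γ.ord.ToType ⊕ γ.ord.ToType × ℕ) →₀ ℤ) := fun i =>
    (relSpan η {w | w ∈ SW ∧ (ToType.toOrd w).1 < i}).toAddSubgroup
  have hFcγ : Fc γ.ord = (relSpan η SW).toAddSubgroup := by
    have : {w | w ∈ SW ∧ (ToType.toOrd w).1 < γ.ord} = SW :=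
      Set.ext fun w => ⟨fun h => h.1, fun h => ⟨h, (ToType.toOrd w).2⟩⟩
    simp only [Fc, this]
  have hstrong := hη.isStronglyKappaFree hγ hγ0 hWcof hWcard hsucc
  have hext := nontrivial_ext_of_guesses hη.lt f hf hBns _ hguess
  have hfree : ∀ i < γ.ord, Module.Free ℤ (((γ.ord.ToType ⊕ γ.ord.ToType × ℕ) →₀ ℤ) ⧸ Fc i) := by
    intro i hi
    refine hη.free_quotient (ToType.mk ⟨i, hi⟩) ?_
    ext w
    rw [Set.mem_inter_iff, Set.mem_Iio, hlt, hmk]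
    rfl
  have hcard := (mk_quotient_le hγ0.le (by rw [mk_toType, card_ord]) _).antisymm
    (le_mk_of_isKappaFree_of_nontrivial_ext hstrong.1 hext)
  refine ⟨_, inferInstance, hstrong, hstrong.1.isAddTorsionFree hγ0, hcard, hTlam, hext,
    (γ.ord.ToType ⊕ γ.ord.ToType × ℕ) →₀ ℤ, inferInstance, Fc, inferInstance, fun i _ => ?_, fun i j hij _ => ?_, ?_,
    fun i _ => rank_relSpan_le η _ i fun w hw => hw.2, hfree,
    ⟨QuotientAddGroup.quotientAddEquivOfEq hFcγ⟩⟩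
  · exact Module.Free.of_injective_addMonoidHom (Fc i).subtype (Fc i).subtype_injective
  · exact relSpan_mono η fun w hw => ⟨hw.1, hw.2.trans_le hij⟩
  · exact coe_relSpan_eq_iUnion hlimit η SW
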